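/- **Corollary 4.2.** Let $\mathbf K$ be an algebraically closed field of characteristic zero and let $H=(u,v,h)$ with $u,v\in\mathbf K[x,y,z]$ and $h\in\mathbf K[x,y]$, with $\deg_z v\le 1$, $H(0)=0$, and $u,v,h$ linearly independent over $\mathbf K$. Assume that the Jacobian matrix $JH$ is nilpotent. Then: 1. If $\deg_z u=0$ and $\gcd(\deg_y u,\deg_y h)\le 3$, then $H$ has the form $$(\ast)\qquad u=g(ay+b(x)),\quad v=v_1z-a^{-1}b'(x)\,g(ay+b(x))-v_1l_2x,\quad h=c_0u^2+l_2u,$$ where $b(x)=v_1c_0a\,x^2+l_1x+\tilde l_2$ with $v_1,c_0,a\in\mathbf K^*$, $l_1,l_2,\tilde l_2\in\mathbf K$, and $g\in\mathbf K[t]$ with $g(0)=0$ and $\deg g\ge 1$. 2. If $\deg_z v=0$ and $\gcd(\deg_x v,\deg_x h)\le 3$, then $H$ has the form $$u=u_1z-a^{-1}b'(y)\,g(ax+b(y))-u_1l_2y,\quad v=g(ax+b(y)),\quad h=c_0v^2+l_2v,$$ where $b(y)=u_1c_0a\,y^2+l_1y+\tilde l_2$ with $u_1,c_0,a\in\mathbf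 K^*$, $l_1,l_2,\tilde l_2\in\mathbf K$, and $g\in\mathbf K[t]$ with $g(0)=0$ and $\deg g\ge 1$. 3. If $\deg_z u\cdot\deg_z v\ge 1$ and $\gcd\bigl(\deg(u(x,y,0)-\lambda v(x,y,0)),\deg h(x,y)\bigr)\le 3$ for some $\lambda\in\mathbf K$, then there is $T\in\mathrm{GL}_3(\mathbf K)$ such that the linear conjugate $T^{-1}\circ H\circ T$ has the form $(\ast)$. Here $\deg$ is the total degree, $\deg_x,\deg_y,\deg_z$ are the degrees in one variable, the zero polynomial is given degree $0$, and $\gcd(0,n)=n$. -/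

import Mathlib

open MvPolynomial

/-- The Jacobian matrix `(∂Hᵢ/∂xⱼ)` of a polynomial map `H : K³ → K³`; the variables `x, y, z` are
`X 0, X 1, X 2`. -/
noncomputable def polyJacobian {K : Type*} [Field K] (H : Fin 3 → MvPolynomial (Fin 3) K) :
    Matrix (Fin 3) (Fin 3) (MvPolynomial (Fin 3) K) :=
  Matrix.of fun i j => pderiv j (H i)

/-- The linear conjugate `T⁻¹ ∘ H ∘ T` of a polynomial map `H : K³ → K³` by `T ∈ GL₃(K)`. -/
noncomputable def linConj {K : Type*} [Field K] (T : GL (Fin 3) K)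
    (H : Fin 3 → MvPolynomial (Fin 3) K) : Fin 3 → MvPolynomial (Fin 3) K :=
  fun i => ∑ j, C ((T⁻¹ : GL (Fin 3) K) i j) * bind₁ (fun k => ∑ l, C (T k l) * X l) (H j)

/-- The polynomial `f(x, y, 0)`. -/
noncomputable def atZZero {K : Type*} [Field K] (f : MvPolynomial (Fin 3) K) :
    MvPolynomial (Fin 3) K :=
  bind₁ ![X 0, X 1, 0] f

/-- The quadratic polynomial `b(t) = α t² + l₁ t + l` in one variable. -/
noncomputable def quadPoly {K : Type*} [Field K] (α l₁ l : K) : Polynomial K :=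
  Polynomial.C α * Polynomial.X ^ 2 + Polynomial.C l₁ * Polynomial.X + Polynomial.C l

/-- `H = (u, v, h)` with `u = g(a y + b(x))`, `v = v₁ z - a⁻¹ b'(x) g(a y + b(x)) - v₁ l₂ x`,
`h = c₀ u² + l₂ u`, where `b(x) = v₁ c₀ a x² + l₁ x + l`, `v₁, c₀, a ≠ 0`, `g(0) = 0` and
`deg g ≥ 1`. -/
def HasFirstForm {K : Type*} [Field K] (H : Fin 3 → MvPolynomial (Fin 3) K) : Prop :=
  ∃ (g : Polynomial K) (v₁ c₀ a l₁ l₂ l : K),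
    v₁ ≠ 0 ∧ c₀ ≠ 0 ∧ a ≠ 0 ∧ g.eval 0 = 0 ∧ 1 ≤ g.natDegree ∧
    H 0 = Polynomial.aeval
      (C a * X 1 + Polynomial.aeval (X 0) (quadPoly (v₁ * c₀ * a) l₁ l)) g ∧
    H 1 = C v₁ * X 2
      - C a⁻¹ * Polynomial.aeval (X 0) (Polynomial.derivative (quadPoly (v₁ * c₀ * a) l₁ l)) *
        Polynomial.aeval (C a * X 1 + Polynomial.aeval (X 0) (quadPoly (v₁ * c₀ * a) l₁ l)) g
      - C (v₁ * l₂) * X 0 ∧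
    H 2 = C c₀ * H 0 ^ 2 + C l₂ * H 0

/-- `H = (u, v, h)` with `u = u₁ z - a⁻¹ b'(y) g(a x + b(y)) - u₁ l₂ y`, `v = g(a x + b(y))`,
`h = c₀ v² + l₂ v`, where `b(y) = u₁ c₀ a y² + l₁ y + l`, `u₁, c₀, a ≠ 0`, `g(0) = 0` and
`deg g ≥ 1`. -/
def HasSecondForm {K : Type*} [Field K] (H : Fin 3 → MvPolynomial (Fin 3) K) : Prop :=
  ∃ (g : Polynomial K) (u₁ c₀ a l₁ l₂ l : K),
    u₁ ≠ 0 ∧ c₀ ≠ 0 ∧ a ≠ 0 ∧ g.eval 0 = 0 ∧ 1 ≤ g.natDegree ∧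
    H 0 = C u₁ * X 2
      - C a⁻¹ * Polynomial.aeval (X 1) (Polynomial.derivative (quadPoly (u₁ * c₀ * a) l₁ l)) *
        Polynomial.aeval (C a * X 0 + Polynomial.aeval (X 1) (quadPoly (u₁ * c₀ * a) l₁ l)) g
      - C (u₁ * l₂) * X 1 ∧
    H 1 = Polynomial.aeval
      (C a * X 0 + Polynomial.aeval (X 1) (quadPoly (u₁ * c₀ * a) l₁ l)) g ∧
    H 2 = C c₀ * H 1 ^ 2 + C l₂ * H 1

/-! Nilpotency of `JH` means that its trace, the sum of its principal 2×2 minors and its determinant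
vanish. These are differential equations in `u, v, h`, and everything is deduced from them and
linear independence.

The central case is `u` and `h` free of `z`, with `v_z` a nonzero constant `k`. The determinant
makes the gradients of `u` and `h` parallel. Let `D = ∂x - (u_x/u_y) ∂y` be differentiation in `x`
along the level curves of `u`, acting on the rational function field. The equations give `D³ y = 0`
(`hessian_flow_constants`), so on each level curve `y = α x² + β x + γ` with coefficients killed by
`D`. Since `x` is transcendental over the constants of `D`, `u(t, α t² + β t + γ)` is constant as a
polynomial in `t`. Its top coefficient shows that `α` is algebraic over `K`, hence in `K`; removing
the quadratic term by a shear puts `β` in `K` too (`hessian_core`). So `u` and `h` are polynomials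
`g` and `G` in `y - α x² - β x`. The remaining equation is an ODE that integrates to `k G = -α g² +
e g`, and `v` is recovered from its gradient (`hasFirstForm`).

The rest is reduction to this case. Comparing leading `z`-coefficients rules out `z`-degree at least
2 in `u` (`u_zz`). The pair `(u_z, v_z)` is then itself a planar map with nilpotent Jacobian, which
forces both entries to be constant (`exists_pderiv_two_eq_C`). The second form follows by exchanging
`x` with `y` and `u` with `v`; in the third case a transvection removes `z` from the first
component. -/

/-! ### Derivations of a fraction field -/

section FractionField

variable {K R F : Type*} [Field K] [CommRing R] [IsDomain R] [Algebra K R] [Field F] [Algebra R F]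
  [IsFractionRing R F] [Algebra K F] [IsScalarTower K R F]

/-- Every derivation of a domain extends to its fraction field. -/
theorem Derivation.exists_extension_fractionField (d : Derivation K R R) :
    ∃ D : Derivation K F F, ∀ r : R, D (algebraMap R F r) = algebraMap R F (d r) := by
  -- A derivation is a ring map `r ↦ r + ε d r` into the dual numbers. Nonzero `r` go to units, so
  -- the map extends to `F`, and its `ε`-part is the extended derivation.
  let φ : R →+* TrivSqZeroExt F F :=
    { toFun := fun r => ((algebraMap R F r, algebraMap R F (d r)) : F × F)
      map_one' := TrivSqZeroExt.ext (map_one _)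
        (show algebraMap R F (d 1) = 0 by rw [Derivation.map_one_eq_zero, map_zero])
      map_zero' := TrivSqZeroExt.ext (map_zero _)
        (show algebraMap R F (d 0) = 0 by rw [map_zero, map_zero])
      map_add' := fun a b => TrivSqZeroExt.ext (map_add _ a b)
        (show algebraMap R F (d (a + b)) = algebraMap R F (d a) + algebraMap R F (d b) by
          rw [map_add, map_add])
      map_mul' := fun a b => TrivSqZeroExt.ext (map_mul _ a b)
        (show algebraMap R F (d (a * b)) =
            algebraMap R F a * algebraMap R F (d b) + algebraMap R F (d a) * algebraMap R F b by
          rw [Derivation.leibniz, smul_eq_mul, smul_eq_mul, map_add, map_mul, map_mul,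
            mul_comm (algebraMap R F b)]) }
  have hφ1 : ∀ r, (φ r).fst = algebraMap R F r := fun _ => rfl
  have hφ2 : ∀ r, (φ r).snd = algebraMap R F (d r) := fun _ => rfl
  have hφ : ∀ y : nonZeroDivisors R, IsUnit (φ y) := by
    intro y
    rw [TrivSqZeroExt.isUnit_iff_isUnit_fst, hφ1, isUnit_iff_ne_zero]
    exact IsFractionRing.to_map_ne_zero_of_mem_nonZeroDivisors y.2
  let ψ : F →+* TrivSqZeroExt F F := IsLocalization.lift hφ
  have hψ : ∀ r, ψ (algebraMap R F r) = φ r := fun r => IsLocalization.lift_eq hφ r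
  have hfst : ∀ f, (ψ f).fst = f := by
    intro f
    have : (TrivSqZeroExt.fstHom F F F).toRingHom.comp ψ = RingHom.id F := by
      apply IsLocalization.ringHom_ext (nonZeroDivisors R)
      ext r
      exact (congrArg TrivSqZeroExt.fst (hψ r)).trans (hφ1 r)
    exact RingHom.congr_fun this f
  have hmul : ∀ a b, (ψ (a * b)).snd = a * (ψ b).snd + b * (ψ a).snd := by
    intro a b
    rw [map_mul, TrivSqZeroExt.snd_mul, hfst, hfst, smul_eq_mul, MulOpposite.smul_eq_mul_unop,
      MulOpposite.unop_op, mul_comm b]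
  have hsnd : ∀ r, (ψ (algebraMap R F r)).snd = algebraMap R F (d r) := by
    intro r
    rw [hψ, hφ2]
  refine ⟨Derivation.mk' (R := K) (A := F) (M := F)
    { toFun := fun f => (ψ f).snd
      map_add' := fun a b => by rw [map_add, TrivSqZeroExt.snd_add]
      map_smul' := ?_ } hmul, hsnd⟩
  intro c f
  rw [Algebra.smul_def, IsScalarTower.algebraMap_apply K R F, hmul, hsnd,
    Derivation.map_algebraMap, map_zero, mul_zero, add_zero, RingHom.id_apply, Algebra.smul_def,
    IsScalarTower.algebraMap_apply K R F]

end FractionField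

theorem Derivation.eq_zero_of_fractionField {K : Type*} (R : Type*) {F : Type*} [Field K]
    [CommRing R] [IsDomain R] [Field F] [Algebra R F] [IsFractionRing R F] [Algebra K F]
    (D : Derivation K F F)
    (hD : ∀ r : R, D (algebraMap R F r) = 0) : D = 0 := by
  ext f
  obtain ⟨a, b, hb, rfl⟩ := IsFractionRing.div_surjective (A := R) f
  have hb' : algebraMap R F b ≠ 0 := by
    simpa using nonZeroDivisors.ne_zero hb
  have h : algebraMap R F a / algebraMap R F b * algebraMap R F b = algebraMap R F a := by
    field_simp
  have h2 := congrArg D h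
  rw [Derivation.leibniz, hD, hD] at h2
  simpa [hb'] using h2

/-! ### Constants of a derivation -/

section ConstantsOfDerivation

variable {K F : Type*} [Field K] [Field F] [Algebra K F]

/-- The constants of a derivation of a field. -/
def Derivation.constants (D : Derivation K F F) : Subalgebra K F where
  carrier := {f | D f = 0}
  mul_mem' := by
    intro a b ha hb
    simp only [Set.mem_ofPred_eq] at *
    simp [ha, hb]
  add_mem' := by
    intro a b ha hb
    simp only [Set.mem_ofPred_eq] at *
    simp [ha, hb]
  algebraMap_mem' := by intro r; simp

/-- On polynomials in `x` over the constants, `D` acts as formal differentiation, so a relation for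
`x` differentiates to one of lower degree. Hence `x` is transcendental over the constants. -/
theorem Derivation.aeval_constants_eq_zero [CharZero F] (D : Derivation K F F) {x : F} (hx : D x = 1)
    (n : ℕ) : ∀ p : Polynomial D.constants, p.natDegree ≤ n → Polynomial.aeval x p = 0 → p = 0 := by
  have key : ∀ p : Polynomial D.constants,
      D (Polynomial.aeval x p) = Polynomial.aeval x (Polynomial.derivative p) := by
    intro p
    induction p using Polynomial.induction_on' with
    | add p q hp hq => simp [hp, hq]
    | monomial n a =>
      have ha : D (a : F) = 0 := a.2
      rw [Polynomial.aeval_monomial, Polynomial.derivative_monomial, Polynomial.aeval_monomial]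
      simp only [Derivation.leibniz, Derivation.leibniz_pow, hx, Subalgebra.algebraMap_def]
      simp [ha]
      ring
  induction n with
  | zero =>
    intro p hp h
    rw [Polynomial.eq_C_of_natDegree_le_zero hp] at h ⊢
    simpa using h
  | succ n ih =>
    intro p hp h
    have h1 : Polynomial.derivative p = 0 := by
      apply ih _ ((Polynomial.natDegree_derivative_le p).trans (by lia))
      rw [← key, h, map_zero]
    have h2 : p.natDegree = 0 := Polynomial.derivative_eq_zero.mp h1
    rw [Polynomial.eq_C_of_natDegree_eq_zero h2] at h ⊢
    simpa using h

end ConstantsOfDerivation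

/-! ### Weighted top forms and algebraicity -/

section TopForm

theorem mem_range_algebraMap_of_aeval_eq_zero {K A : Type*} [Field K] [IsAlgClosed K] [CommRing A]
    [IsDomain A] [Algebra K A] (α : A) (p : Polynomial K) (hp : p ≠ 0)
    (h : Polynomial.aeval α p = 0) : ∃ c : K, algebraMap K A c = α := by
  have hα : IsIntegral K α := isAlgebraic_iff_isIntegral.mp ⟨p, hp, h⟩
  have hi := minpoly.irreducible hα
  have hd := IsAlgClosed.degree_eq_one_of_irreducible K hi
  exact minpoly.mem_range_of_degree_eq_one K α hd

/-- If a nonconstant polynomial `P(x, y)` becomes constant on `(t, S(t))` with `deg S ≤ r`, then the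
coefficient of `S` in degree `r` is algebraic over the base field. -/
theorem exists_algebraMap_eq_coeff {K A : Type*} [Field K] [IsAlgClosed K] [CommRing A] [IsDomain A]
    [Algebra K A] (P : MvPolynomial (Fin 3) K) (hP : ∀ m ∈ P.support, m 2 = 0)
    (hP' : ∃ m ∈ P.support, m ≠ 0) (S : Polynomial A) (r : ℕ) (hr : 1 ≤ r) (hS : S.natDegree ≤ r)
    (b a : A) (h : aeval ![Polynomial.X, S, Polynomial.C b] P = Polynomial.C a) :
    ∃ c : K, algebraMap K A c = S.coeff r := by
  classical
  -- With weights 1 for `x` and `r` for `y`, only monomials of maximal weight `d` reach degree `d`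
  -- in `P(t, S(t))`. They contribute `Q(S.coeff r)`, where `Q` is the top form at `x = 1`; this
  -- vanishes because `d > 0`.
  let wt : (Fin 3 →₀ ℕ) → ℕ := fun m => m 0 + m 1 * r
  let d := P.support.sup wt
  have hle : ∀ m ∈ P.support, wt m ≤ d := fun m hm => Finset.le_sup (f := wt) hm
  obtain ⟨m₀, hm₀, hm₀d⟩ : ∃ m ∈ P.support, wt m = d := by
    obtain ⟨m, hm, -⟩ := hP'
    obtain ⟨m', h1, h2⟩ := Finset.exists_mem_eq_sup P.support ⟨m, hm⟩ wt
    exact ⟨m', h1, h2.symm⟩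
  have hd : 0 < d := by
    obtain ⟨m, hm, hm0⟩ := hP'
    refine lt_of_lt_of_le ?_ (hle m hm)
    rw [Nat.pos_iff_ne_zero]
    intro h0
    simp only [wt, Nat.add_eq_zero_iff, Nat.mul_eq_zero] at h0
    apply hm0
    ext i
    fin_cases i
    · simpa using h0.1
    · rcases h0.2 with h | h
      · simpa using h
      · lia
    · simpa using hP m hm
  let Q : Polynomial K := ∑ m ∈ P.support with wt m = d, Polynomial.monomial (m 1) (coeff m P)
  -- No cancellation: at fixed weight, the exponent of `y` determines that of `x`.
  have hQ : Q ≠ 0 := by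
    intro h0
    have h1 : Q.coeff (m₀ 1) = coeff m₀ P := by
      simp only [Q, Polynomial.finsetSum_coeff, Polynomial.coeff_monomial]
      rw [Finset.sum_eq_single m₀]
      · simp
      · intro m hm hne
        rw [if_neg]
        intro h1
        apply hne
        have h2 : wt m = wt m₀ := by rw [(Finset.mem_filter.mp hm).2, hm₀d]
        have h3 : m 0 = m₀ 0 := by simp only [wt, h1] at h2; lia
        ext i
        fin_cases i
        · simpa using h3
        · simpa using h1
        · simpa [hP m₀ hm₀] using hP m (Finset.mem_filter.mp hm).1
      · intro hn
        exact absurd (Finset.mem_filter.mpr ⟨hm₀, hm₀d⟩) hn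
    rw [h0, Polynomial.coeff_zero] at h1
    exact (mem_support_iff.mp hm₀) h1.symm
  apply mem_range_algebraMap_of_aeval_eq_zero _ Q hQ
  have h1 := congrArg (fun p => Polynomial.coeff p d) h
  simp only [Polynomial.coeff_C, hd.ne', if_false] at h1
  rw [aeval_def, eval₂_eq', Polynomial.finsetSum_coeff] at h1
  rw [← h1]
  simp only [Q, map_sum]
  rw [Finset.sum_filter]
  apply Finset.sum_congr rfl
  intro m hm
  have hSp : (S ^ (m 1)).natDegree ≤ m 1 * r :=
    Polynomial.natDegree_pow_le.trans (Nat.mul_le_mul_left _ hS)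
  simp only [Fin.prod_univ_three, Matrix.cons_val_zero, Matrix.cons_val_one, Matrix.cons_val]
  rw [hP m hm, pow_zero, mul_one, Polynomial.algebraMap_apply,
    Polynomial.coeff_C_mul]
  rw [Polynomial.coeff_X_pow_mul']
  split_ifs with h2 h3 h3
  · rw [← h2]
    simp only [wt, Nat.add_sub_cancel_left]
    rw [Polynomial.coeff_pow_of_natDegree_le hS, Polynomial.aeval_monomial]
  · simp only [wt] at h2; lia
  · have h4 := lt_of_le_of_ne (hle m hm) h2
    rw [Polynomial.coeff_eq_zero_of_natDegree_lt (lt_of_le_of_lt hSp _), mul_zero]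
    simp only [wt] at h4; lia
  · simp

end TopForm

/-! ### Partial derivatives of polynomials -/

section PartialDerivatives

theorem pderiv_pderiv_comm {K σ : Type*} [Field K] (i j : σ) (f : MvPolynomial σ K) :
    pderiv i (pderiv j f) = pderiv j (pderiv i f) := by
  classical
  have h : ⁅(pderiv i : Derivation K (MvPolynomial σ K) (MvPolynomial σ K)),
      (pderiv j : Derivation K (MvPolynomial σ K) (MvPolynomial σ K))⁆ = 0 := by
    apply MvPolynomial.derivation_ext
    intro k
    rw [Derivation.commutator_apply]
    by_cases h1 : k = i <;> by_cases h2 : k = j <;> simp [Pi.single_apply, h1, h2] <;>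
      split_ifs <;> simp
  have h2 := DFunLike.congr_fun h f
  rw [Derivation.commutator_apply] at h2
  exact sub_eq_zero.mp h2

theorem eq_zero_of_mem_support_of_pderiv_eq_zero {K σ : Type*} [Field K] [CharZero K] {i : σ}
    {f : MvPolynomial σ K} (hf : pderiv i f = 0) (m : σ →₀ ℕ) (hm : m ∈ f.support) : m i = 0 := by
  classical
  by_contra h
  have h1 := coeff_pderiv (i := i) f (m - Finsupp.single i 1)
  rw [hf, coeff_zero] at h1
  have h2 : m - Finsupp.single i 1 + Finsupp.single i 1 = m := by
    ext j
    by_cases hj : j = i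
    · subst hj; simp; lia
    · simp [Ne.symm hj]
  rw [h2] at h1
  have h3 : (((m - Finsupp.single i 1 : σ →₀ ℕ) i : ℕ) : K) + 1 ≠ 0 := Nat.cast_add_one_ne_zero _
  exact (mul_ne_zero (mem_support_iff.mp hm) h3) h1.symm

theorem exists_eq_C_of_pderiv_eq_zero {K σ : Type*} [Field K] [CharZero K]
    {f : MvPolynomial σ K} (hf : ∀ i, pderiv i f = 0) : ∃ c, f = C c := by
  classical
  refine ⟨coeff 0 f, ?_⟩
  ext m
  rw [coeff_C]
  split_ifs with h
  · rw [h]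
  · by_contra h1
    apply h
    ext i
    simpa using (eq_zero_of_mem_support_of_pderiv_eq_zero (hf i) m (mem_support_iff.mpr h1)).symm

theorem exists_mem_support_ne_zero {K σ : Type*} [Field K] {i : σ}
    {f : MvPolynomial σ K} (hf : pderiv i f ≠ 0) : ∃ m ∈ f.support, m ≠ 0 := by
  classical
  by_contra! h
  apply hf
  have h1 : f = C (coeff 0 f) := by
    ext m
    rw [coeff_C]
    split_ifs with h2
    · rw [h2]
    · by_contra h3
      exact h2 (h m (mem_support_iff.mpr h3)).symm
  rw [h1, pderiv_C]

end PartialDerivatives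

/-! ### Shears in the `x, y` plane -/

section Shear

variable {K : Type*} [Field K]

/-- The substitution `y ↦ y + s(x)`. -/
noncomputable def shear (s : Polynomial K) : MvPolynomial (Fin 3) K →ₐ[K] MvPolynomial (Fin 3) K :=
  aeval ![X 0, X 1 + Polynomial.aeval (X 0) s, X 2]

theorem shear_X_zero (s : Polynomial K) : shear s (X 0) = X 0 := by simp [shear]

theorem shear_X_one (s : Polynomial K) : shear s (X 1) = X 1 + Polynomial.aeval (X 0) s := by
  simp [shear]

theorem shear_X_two (s : Polynomial K) : shear s (X 2) = X 2 := by simp [shear]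

theorem shear_neg_shear (s : Polynomial K) (f : MvPolynomial (Fin 3) K) :
    shear (-s) (shear s f) = f := by
  have h : (shear (-s)).comp (shear s) = AlgHom.id K _ := by
    apply MvPolynomial.algHom_ext
    intro i
    fin_cases i
    · simp [shear_X_zero]
    · simp [shear_X_one, ← Polynomial.aeval_algHom_apply, shear_X_zero]
    · simp [shear_X_two]
  exact DFunLike.congr_fun h f

theorem shear_injective (s : Polynomial K) : Function.Injective (shear s) :=
  Function.LeftInverse.injective (shear_neg_shear s)

theorem pderiv_aeval_X (i j : Fin 3) (s : Polynomial K) :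
    pderiv i (Polynomial.aeval (X j : MvPolynomial (Fin 3) K) s) =
      pderiv i (X j) * Polynomial.aeval (X j) (Polynomial.derivative s) := by
  rw [Derivation.comp_aeval_eq]
  simp [mul_comm]

theorem pderiv_shear_zero (s : Polynomial K) (f : MvPolynomial (Fin 3) K) :
    pderiv 0 (shear s f) = shear s (pderiv 0 f) +
      Polynomial.aeval (X 0) (Polynomial.derivative s) * shear s (pderiv 1 f) := by
  induction f using MvPolynomial.induction_on with
  | C a => simp [← MvPolynomial.algebraMap_eq]
  | add p q hp hq => simp only [map_add, hp, hq]; ring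
  | mul_X p i h =>
    fin_cases i
    · simp [h, shear_X_zero, pderiv_X]; ring
    · simp [h, shear_X_one, pderiv_X]; ring
    · simp [h, shear_X_two, pderiv_X]; ring

theorem pderiv_shear_one (s : Polynomial K) (f : MvPolynomial (Fin 3) K) :
    pderiv 1 (shear s f) = shear s (pderiv 1 f) := by
  induction f using MvPolynomial.induction_on with
  | C a => simp [← MvPolynomial.algebraMap_eq]
  | add p q hp hq => simp only [map_add, hp, hq]
  | mul_X p i h =>
    fin_cases i
    · simp [h, shear_X_zero, pderiv_X]
    · simp [h, shear_X_one, pderiv_X]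
    · simp [h, shear_X_two, pderiv_X]

theorem pderiv_shear_two (s : Polynomial K) (f : MvPolynomial (Fin 3) K) :
    pderiv 2 (shear s f) = shear s (pderiv 2 f) := by
  induction f using MvPolynomial.induction_on with
  | C a => simp [← MvPolynomial.algebraMap_eq]
  | add p q hp hq => simp only [map_add, hp, hq]
  | mul_X p i h =>
    fin_cases i
    · simp [h, shear_X_zero, pderiv_X]
    · simp [h, shear_X_one, pderiv_X]
    · simp [h, shear_X_two, pderiv_X]

end Shear

/-! ### Polynomials in one variable -/

section OneVariable

variable {K : Type*} [Field K] [CharZero K]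

theorem exists_eq_aeval_X_one {f : MvPolynomial (Fin 3) K} (h0 : pderiv 0 f = 0)
    (h2 : pderiv 2 f = 0) : ∃ p : Polynomial K, f = Polynomial.aeval (X 1) p := by
  classical
  refine ⟨∑ m ∈ f.support, Polynomial.monomial (m 1) (coeff m f), ?_⟩
  rw [map_sum]
  conv_lhs => rw [f.as_sum]
  apply Finset.sum_congr rfl
  intro m hm
  have e0 := eq_zero_of_mem_support_of_pderiv_eq_zero h0 m hm
  have e2 := eq_zero_of_mem_support_of_pderiv_eq_zero h2 m hm
  rw [Polynomial.aeval_monomial, monomial_eq, Finsupp.prod_fintype _ _ (by simp)]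
  simp [Fin.prod_univ_three, e0, e2]

theorem aeval_X_injective {K : Type*} [Field K] (i : Fin 3) :
    Function.Injective (Polynomial.aeval (R := K) (X i : MvPolynomial (Fin 3) K)) := by
  have h : Function.LeftInverse (aeval fun _ : Fin 3 => (Polynomial.X : Polynomial K))
      (Polynomial.aeval (R := K) (X i : MvPolynomial (Fin 3) K)) := by
    intro p
    rw [← Polynomial.aeval_algHom_apply]
    simp
  exact h.injective

/-- If `p q' = N q p'` then `q` has the degree of `p ^ N`. -/
theorem natDegree_eq_of_mul_derivative_eq {p q : Polynomial K} (hp : p ≠ 0) (hq : q ≠ 0) (N : ℕ)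
    (h : p * Polynomial.derivative q = N * (q * Polynomial.derivative p)) :
    q.natDegree = N * p.natDegree := by
  -- The Euler operator `X · d/dX` does not raise the degree and multiplies the leading coefficient
  -- by the degree, so top coefficients can be compared.
  have hX : ∀ r : Polynomial K, (Polynomial.X * Polynomial.derivative r).natDegree ≤ r.natDegree ∧
      (Polynomial.X * Polynomial.derivative r).coeff r.natDegree = r.natDegree * r.leadingCoeff := by
    intro r
    have hc : ∀ n, (Polynomial.X * Polynomial.derivative r).coeff n = n * r.coeff n := by
      intro n
      cases n with
      | zero => simp
      | succ n => rw [Polynomial.coeff_X_mul, Polynomial.coeff_derivative]; push_cast; ring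
    refine ⟨?_, hc _⟩
    rw [Polynomial.natDegree_le_iff_coeff_eq_zero]
    intro n hn
    rw [hc, Polynomial.coeff_eq_zero_of_natDegree_lt hn, mul_zero]
  have h1 : p * (Polynomial.X * Polynomial.derivative q) =
      Polynomial.C (N : K) * (q * (Polynomial.X * Polynomial.derivative p)) := by
    rw [Polynomial.C_eq_natCast]
    linear_combination Polynomial.X * h
  have h2 := congrArg (fun r => Polynomial.coeff r (p.natDegree + q.natDegree)) h1
  beta_reduce at h2
  rw [Polynomial.coeff_C_mul, Polynomial.coeff_mul_add_eq_of_natDegree_le le_rfl (hX q).1,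
    add_comm, Polynomial.coeff_mul_add_eq_of_natDegree_le le_rfl (hX p).1, (hX q).2, (hX p).2,
    Polynomial.coeff_natDegree, Polynomial.coeff_natDegree] at h2
  have hp' := Polynomial.leadingCoeff_ne_zero.mpr hp
  have hq' := Polynomial.leadingCoeff_ne_zero.mpr hq
  have h3 : (q.natDegree : K) = N * p.natDegree := by
    apply mul_left_cancel₀ (mul_ne_zero hp' hq')
    linear_combination h2
  exact_mod_cast h3

/-- Polynomials in one variable with vanishing Wronskian are proportional. -/
theorem exists_eq_C_mul_of_wronskian_eq_zero {p q : Polynomial K} (hq : q ≠ 0)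
    (h : p * Polynomial.derivative q = q * Polynomial.derivative p) :
    ∃ e, p = Polynomial.C e * q := by
  -- This `e` kills the coefficient of `p - e q` in degree `deg q`. A nonzero difference would still
  -- have zero Wronskian with `q`, hence degree exactly `deg q`.
  set e := p.coeff q.natDegree / q.leadingCoeff with he
  refine ⟨e, ?_⟩
  by_contra hne
  have hr : p - Polynomial.C e * q ≠ 0 := sub_ne_zero.mpr hne
  have h1 := natDegree_eq_of_mul_derivative_eq hr hq 1 (by simp; linear_combination h)
  apply hr
  rw [← Polynomial.leadingCoeff_eq_zero, ← Polynomial.coeff_natDegree]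
  rw [one_mul] at h1
  rw [← h1, Polynomial.coeff_sub, Polynomial.coeff_C_mul, he, Polynomial.coeff_natDegree,
    div_mul_cancel₀ _ (Polynomial.leadingCoeff_ne_zero.mpr hq), sub_self]

end OneVariable

/-! ### The flow along the level curves of `u` -/

section FieldCore

variable {K F : Type*} [Field K] [Field F] [Algebra K F]

/-- With `p = u_x/u_y`, the commutator of `D` and `∂y` is `p_y ∂y`, so `f ↦ f_y/u_y` preserves the
constants of `D`. As `D h = 0`, both `c = h_y/u_y` and `c_y/u_y` are constants. The minor equation
says `D w = c`; applying `∂y` yields `D p = c_y/u_y`. -/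
theorem hessian_flow_constants (dx dy D : Derivation K F F)
    (hcomm : ∀ f, dx (dy f) = dy (dx f)) (u w h : F) (hu : dy u ≠ 0) (h1 : dy w = dx u)
    (h2 : dx u ^ 2 - dy u * dx w + dy h = 0) (h3 : dx u * dy h = dy u * dx h)
    (hD : ∀ f, D f = dx f - dx u / dy u * dy f) :
    D u = 0 ∧ D (dx u / dy u) = dy (dy h / dy u) / dy u ∧ D (dy (dy h / dy u) / dy u) = 0 := by
  have hDu : D u = 0 := by rw [hD]; field_simp; ring
  have hdiv : ∀ (E : Derivation K F F) (f : F), E (f / dy u) * dy u = E f - f / dy u * E (dy u) := by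
    intro E f
    have h4 : E (f / dy u * dy u) = E f := by rw [div_mul_cancel₀ _ hu]
    rw [Derivation.leibniz, smul_eq_mul, smul_eq_mul] at h4
    linear_combination h4
  set p := dx u / dy u with hp
  have hpu : p * dy u = dx u := div_mul_cancel₀ _ hu
  have hDdy : ∀ f, D (dy f) = dy (D f) + dy p * dy f := by
    intro f
    rw [hD f, hD (dy f), map_sub, Derivation.leibniz, smul_eq_mul, smul_eq_mul, hcomm]
    ring
  have hDdiv : ∀ f, D f = 0 → D (dy f / dy u) = 0 := by
    intro f hf
    apply mul_right_cancel₀ hu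
    rw [hdiv, hDdy, hDdy, hf, hDu, map_zero]
    field_simp
    ring
  have hDh : D h = 0 := by
    rw [hD, hp]
    field_simp
    linear_combination -h3
  refine ⟨hDu, ?_, hDdiv _ (hDdiv _ hDh)⟩
  set c := dy h / dy u with hc
  have hcu : c * dy u = dy h := div_mul_cancel₀ _ hu
  have hDw : D w = c := by
    rw [hD, h1]
    apply mul_right_cancel₀ hu
    rw [hcu]
    linear_combination -h2 - dx u * hpu
  have hDux : D (dx u) = dy c + dy p * dx u := by
    rw [← h1, hDdy, hDw]
  rw [eq_div_iff hu, hp, hdiv, hDux, hDdy, hDu, map_zero, ← hpu]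
  field_simp
  ring

/-- `y` is a quadratic polynomial in `x` over the constants of the derivation along the level sets
of `u`. -/
theorem exists_constants_quadratic [CharZero F] (dx dy D : Derivation K F F)
    (hcomm : ∀ f, dx (dy f) = dy (dx f)) (u w h x y : F) (hu : dy u ≠ 0) (h1 : dy w = dx u)
    (h2 : dx u ^ 2 - dy u * dx w + dy h = 0) (h3 : dx u * dy h = dy u * dx h)
    (hD : ∀ f, D f = dx f - dx u / dy u * dy f)
    (hxx : dx x = 1) (hxy : dy x = 0) (hyx : dx y = 0) (hyy : dy y = 1) :
    ∃ α β γ : D.constants, y = α * x ^ 2 + β * x + γ ∧ dx u = -(2 * α * x + β) * dy u ∧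
      dy (dy h / dy u) = -2 * α * dy u := by
  obtain ⟨-, e1, e2⟩ := hessian_flow_constants dx dy D hcomm u w h hu h1 h2 h3 hD
  set p := dx u / dy u with hp
  have hDx : D x = 1 := by rw [hD, hxx, hxy]; ring
  have hDy : D y = -p := by rw [hD, hyx, hyy]; ring
  have hpu : p * dy u = dx u := div_mul_cancel₀ _ hu
  set c := dy (dy h / dy u) / dy u with hc
  have hcu : c * dy u = dy (dy h / dy u) := div_mul_cancel₀ _ hu
  -- From `D x = 1`, `D y = -p`, `D p = c`, `D c = 0`, integration in `x` gives `α = -c/2` and `β =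
  -- -p + c x`; `γ` is the remainder.
  have hα : D (-(c / 2)) = 0 := by
    have h4 : D (c / 2 + c / 2) = 0 := by rw [add_halves, e2]
    rw [map_add, ← two_mul] at h4
    rw [map_neg, (mul_eq_zero.mp h4).resolve_left two_ne_zero, neg_zero]
  have hβ : D (-p + c * x) = 0 := by
    rw [map_add, map_neg, Derivation.leibniz, e1, e2, hDx, smul_eq_mul, smul_eq_mul]
    ring
  have hγ : D (y - (-(c / 2)) * x ^ 2 - (-p + c * x) * x) = 0 := by
    rw [map_sub, map_sub, Derivation.leibniz, Derivation.leibniz _ (-p + c * x), hβ, hα,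
      pow_two x, Derivation.leibniz, hDx, hDy]
    simp only [smul_eq_mul]
    ring
  refine ⟨⟨_, hα⟩, ⟨_, hβ⟩, ⟨_, hγ⟩, ?_, ?_, ?_⟩
  · ring
  · linear_combination -hpu
  · rw [← hcu]
    ring

end FieldCore

/-! ### Descent of the coefficients to the base field -/

section PolynomialCore

variable {K : Type*} [Field K] [IsAlgClosed K] [CharZero K]

/-- The coefficients `α, β` of the quadratic level curves are constants of `D` that turn out
algebraic over `K`. The second equation is `(h_y/u_y)_y = -2α u_y` with denominators cleared. -/
theorem hessian_core (u w h : MvPolynomial (Fin 3) K) (huz : pderiv 2 u = 0) (hu : pderiv 1 u ≠ 0)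
    (h1 : pderiv 1 w = pderiv 0 u)
    (h2 : pderiv 0 u ^ 2 - pderiv 1 u * pderiv 0 w + pderiv 1 h = 0)
    (h3 : pderiv 0 u * pderiv 1 h = pderiv 1 u * pderiv 0 h) :
    ∃ α β : K, pderiv 0 u = -(C (2 * α) * X 0 + C β) * pderiv 1 u ∧
      pderiv 1 (pderiv 1 h) * pderiv 1 u - pderiv 1 h * pderiv 1 (pderiv 1 u) =
        -C (2 * α) * pderiv 1 u ^ 3 := by
  let R := MvPolynomial (Fin 3) K
  let F := FractionRing R
  let ι := algebraMap R F
  have hι : Function.Injective ι := IsFractionRing.injective R F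
  obtain ⟨dx, hdx⟩ := Derivation.exists_extension_fractionField (F := F)
    (pderiv 0 : Derivation K R R)
  obtain ⟨dy, hdy⟩ := Derivation.exists_extension_fractionField (F := F)
    (pderiv 1 : Derivation K R R)
  have hcomm : ∀ f, dx (dy f) = dy (dx f) := by
    intro f
    have h4 : ⁅dx, dy⁆ = 0 := by
      apply Derivation.eq_zero_of_fractionField R
      intro r
      rw [Derivation.commutator_apply, hdy, hdx, hdx, hdy, pderiv_pderiv_comm, sub_self]
    have h5 := DFunLike.congr_fun h4 f
    rw [Derivation.commutator_apply] at h5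
    exact sub_eq_zero.mp h5
  let D : Derivation K F F := dx - (dx (ι u) / dy (ι u)) • dy
  have hD : ∀ f, D f = dx f - dx (ι u) / dy (ι u) * dy f := fun f => rfl
  have huF : dy (ι u) ≠ 0 := by
    rw [hdy]
    exact (map_ne_zero_iff ι hι).mpr hu
  have e1 : dy (ι w) = dx (ι u) := by rw [hdy, hdx, h1]
  have e2 : dx (ι u) ^ 2 - dy (ι u) * dx (ι w) + dy (ι h) = 0 := by
    rw [hdx, hdx, hdy, hdy, ← map_pow, ← map_mul, ← map_sub, ← map_add, h2, map_zero]
  have e3 : dx (ι u) * dy (ι h) = dy (ι u) * dx (ι h) := by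
    rw [hdx, hdx, hdy, hdy, ← map_mul, ← map_mul, h3]
  have hx : dx (algebraMap R F (X 0)) = 1 := by rw [hdx, pderiv_X_self, map_one]
  have hx' : dy (algebraMap R F (X 0)) = 0 := by rw [hdy, pderiv_X_of_ne (by decide), map_zero]
  have hy : dx (algebraMap R F (X 1)) = 0 := by rw [hdx, pderiv_X_of_ne (by decide), map_zero]
  have hy' : dy (algebraMap R F (X 1)) = 1 := by rw [hdy, pderiv_X_self, map_one]
  have hz : dx (algebraMap R F (X 2)) = 0 := by rw [hdx, pderiv_X_of_ne (by decide), map_zero]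
  have hz' : dy (algebraMap R F (X 2)) = 0 := by rw [hdy, pderiv_X_of_ne (by decide), map_zero]
  have hu0 : D (ι u) = 0 := (hessian_flow_constants dx dy D hcomm _ _ _ huF e1 e2 e3 hD).1
  obtain ⟨α, β, γ, g1, g2, g3⟩ := exists_constants_quadratic dx dy D hcomm _ _ _ _ _ huF e1 e2 e3 hD
    hx hx' hy hy'
  let ζ : D.constants := ⟨ι (X 2), by
    change D (ι (X 2)) = 0
    rw [hD]
    change dx (algebraMap R F (X 2)) - _ * dy (algebraMap R F (X 2)) = 0
    rw [hz, hz', mul_zero, sub_zero]⟩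
  have hx1 : D (ι (X 0)) = 1 := by
    rw [hD]
    change dx (algebraMap R F (X 0)) - _ * dy (algebraMap R F (X 0)) = 1
    rw [hx, hx', mul_zero, sub_zero]
  let S : Polynomial D.constants :=
    Polynomial.C α * Polynomial.X ^ 2 + Polynomial.C β * Polynomial.X + Polynomial.C γ
  -- Both sides agree at `t = x`, which is transcendental over the constants.
  have hev : aeval ![Polynomial.X, S, Polynomial.C ζ] u = Polynomial.C ⟨ι u, hu0⟩ := by
    rw [← sub_eq_zero]
    apply Derivation.aeval_constants_eq_zero D hx1 _ _ le_rfl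
    rw [map_sub, sub_eq_zero, Polynomial.aeval_C]
    have h4 : ((Polynomial.aeval (ι (X 0)) : Polynomial D.constants →ₐ[D.constants] F).restrictScalars
        K).comp (aeval ![Polynomial.X, S, Polynomial.C ζ]) = IsScalarTower.toAlgHom K R F := by
      apply MvPolynomial.algHom_ext
      intro i
      fin_cases i
      · simp; rfl
      · simp [S]
        exact g1.symm
      · simp; rfl
    exact DFunLike.congr_fun h4 u
  have hsupp : ∀ f : R, pderiv 2 f = 0 → ∀ m ∈ f.support, m 2 = 0 :=
    fun f hf m hm => eq_zero_of_mem_support_of_pderiv_eq_zero hf m hm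
  have hSdeg : S.natDegree ≤ 2 := Polynomial.natDegree_quadratic_le
  obtain ⟨a, ha⟩ := exists_algebraMap_eq_coeff u (hsupp u huz) (exists_mem_support_ne_zero hu) S 2
    (by norm_num) hSdeg ζ _ hev
  have hα : algebraMap K D.constants a = α := by
    rw [ha]
    simp [S]
  -- Once `α` is in `K`, the shear by `a x²` makes the level curves linear, so `β` becomes the top
  -- coefficient.
  let s : Polynomial K := Polynomial.C a * Polynomial.X ^ 2
  let S' : Polynomial D.constants := Polynomial.C β * Polynomial.X + Polynomial.C γ
  have hev' : aeval ![Polynomial.X, S', Polynomial.C ζ] (shear s u) = Polynomial.C ⟨ι u, hu0⟩ := by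
    rw [← hev]
    have h4 : (aeval ![Polynomial.X, S', Polynomial.C ζ] : R →ₐ[K] Polynomial D.constants).comp
        (shear s) = aeval ![Polynomial.X, S, Polynomial.C ζ] := by
      apply MvPolynomial.algHom_ext
      intro i
      fin_cases i
      · simp [shear_X_zero]
      · simp [shear_X_one, S', S, s, Polynomial.algebraMap_apply, hα]
        ring
      · simp [shear_X_two]
    exact DFunLike.congr_fun h4 u
  have hu1 : pderiv 1 (shear s u) ≠ 0 := by
    rw [pderiv_shear_one]
    exact (map_ne_zero_iff _ (shear_injective s)).mpr hu
  obtain ⟨b, hb⟩ := exists_algebraMap_eq_coeff (shear s u)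
    (hsupp _ (by rw [pderiv_shear_two, huz, map_zero])) (exists_mem_support_ne_zero hu1) S' 1
    le_rfl Polynomial.natDegree_linear_le ζ _ hev'
  have hβ : algebraMap K D.constants b = β := by
    rw [hb]
    simp [S', Polynomial.coeff_C]
  have hα' : (α : F) = ι (C a) := by
    rw [← hα]
    rfl
  have hβ' : (β : F) = ι (C b) := by
    rw [← hβ]
    rfl
  have h2' : (2 : F) = ι (C 2) := by
    rw [show (C 2 : R) = 2 from map_ofNat C 2, map_ofNat]
  refine ⟨a, b, ?_, ?_⟩
  · apply hι
    have e4 : dx (ι u) = ι (pderiv 0 u) := hdx u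
    have e5 : dy (ι u) = ι (pderiv 1 u) := hdy u
    rw [← e4, g2, e5, hα', hβ', h2']
    simp only [map_mul, map_neg, map_add]
    rfl
  · apply hι
    have e5 : dy (ι u) = ι (pderiv 1 u) := hdy u
    have e6 : dy (ι (pderiv 1 u)) = ι (pderiv 1 (pderiv 1 u)) := hdy _
    have e7 : dy (ι h) = ι (pderiv 1 h) := hdy _
    have e8 : dy (ι (pderiv 1 h)) = ι (pderiv 1 (pderiv 1 h)) := hdy _
    change ι _ = ι _
    simp only [map_mul, map_neg, map_sub, map_pow]
    rw [← h2', ← hα', ← e6, ← e8, ← e5, ← e7]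
    set U := dy (ι u)
    set c := dy (ι h) / U with hc
    have hcU : c * U = dy (ι h) := div_mul_cancel₀ _ huF
    have h5 := congrArg dy hcU
    rw [Derivation.leibniz, smul_eq_mul, smul_eq_mul, g3] at h5
    linear_combination (-U) * h5 + dy U * hcU

end PolynomialCore

/-- Only two terms of Leibniz's formula survive. This extracts `z`-coefficients of products in which
one factor has `z`-degree at most 1. -/
theorem Derivation.iterate_mul_of_apply_apply_eq_zero {k A : Type*} [CommRing k] [CommRing A]
    [Algebra k A] (D : Derivation k A A) (f g : A) (hg : D (D g) = 0) (n : ℕ) :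
    D^[n + 1] (f * g) = D^[n + 1] f * g + (n + 1 : ℕ) * (D^[n] f * D g) := by
  induction n with
  | zero => simp; ring
  | succ n ih =>
    rw [Function.iterate_succ_apply', ih, map_add, Derivation.leibniz, Derivation.leibniz,
      Derivation.leibniz, Derivation.map_natCast, hg, Function.iterate_succ_apply' D (n + 1),
      Function.iterate_succ_apply' D n]
    simp only [smul_eq_mul]
    push_cast
    ring

/-! ### The nilpotency equations and their `z`-derivatives -/

section System

variable {K : Type*} [Field K]

local notation "∂₀" => pderiv (0 : Fin 3)
local notation "∂₁" => pderiv (1 : Fin 3)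
local notation "∂₂" => pderiv (2 : Fin 3)

/-- The equations saying that the Jacobian matrix of `(u, v, h)` is nilpotent, for `h` free of `z` and
`v` of degree at most one in `z`, together with the linear independence of `u, v, h` modulo
constants. -/
structure NilpotentSystem (u v h : MvPolynomial (Fin 3) K) : Prop where
  h_z : ∂₂ h = 0
  v_zz : ∂₂ (∂₂ v) = 0
  trace : ∂₀ u + ∂₁ v = 0
  minors : ∂₀ u * ∂₁ v - ∂₁ u * ∂₀ v - ∂₂ u * ∂₀ h - ∂₂ v * ∂₁ h = 0
  det : ∂₂ u * (∂₀ v * ∂₁ h - ∂₁ v * ∂₀ h) - ∂₂ v * (∂₀ u * ∂₁ h - ∂₁ u * ∂₀ h) = 0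
  indep : ∀ a b c : K, (∀ i, pderiv i (C a * u + C b * v + C c * h) = 0) → a = 0 ∧ b = 0 ∧ c = 0

namespace NilpotentSystem

variable {u v h : MvPolynomial (Fin 3) K}

theorem false_of_proportional (H : NilpotentSystem u v h) (a b c : K)
    (habc : a ≠ 0 ∨ b ≠ 0 ∨ c ≠ 0) (h0 : C a * ∂₀ u + C b * ∂₀ v + C c * ∂₀ h = 0)
    (h1 : C a * ∂₁ u + C b * ∂₁ v + C c * ∂₁ h = 0)
    (h2 : C a * ∂₂ u + C b * ∂₂ v + C c * ∂₂ h = 0) : False := by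
  have h3 := H.indep a b c (by
    intro i
    simp only [map_add, pderiv_C_mul]
    fin_cases i
    · exact h0
    · exact h1
    · exact h2)
  simp [h3] at habc

theorem h_ne (H : NilpotentSystem u v h) (h0 : ∂₀ h = 0) : ∂₁ h ≠ 0 := fun h1 =>
  H.false_of_proportional 0 0 1 (by simp) (by simp [h0]) (by simp [h1]) (by simp [H.h_z])

/-- Here `h_y ≠ 0`, and the determinant and minor equations then force `v_y = v_z = 0`, so `v` would
be constant. -/
theorem false_of_pderiv_zero_eq_zero (H : NilpotentSystem u v h) (hv : ∂₀ v = 0) (hh : ∂₀ h = 0) :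
    False := by
  have hy := H.h_ne hh
  have h1 : ∂₀ u = -∂₁ v := eq_neg_of_add_eq_zero_left H.trace
  have h2 := H.det
  have h3 := H.minors
  rw [hv, hh, h1] at h2 h3
  have h4 : ∂₂ v * ∂₁ v = 0 := by
    apply (mul_eq_zero.mp _).resolve_right hy
    linear_combination h2
  have h5 : ∂₁ v = 0 := by
    rcases mul_eq_zero.mp h4 with h5 | h5
    · rw [h5] at h3
      apply pow_eq_zero_iff (two_ne_zero) |>.mp
      linear_combination -h3
    · exact h5
  have h6 : ∂₂ v = 0 := by
    rw [h5] at h3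
    apply (mul_eq_zero.mp _).resolve_right hy
    linear_combination -h3
  exact H.false_of_proportional 0 1 0 (by simp) (by simp [hv]) (by simp [h5]) (by simp [h6])

theorem iterate_pderiv_comm (i j : Fin 3) (n : ℕ) (f : MvPolynomial (Fin 3) K) :
    pderiv i ((pderiv j)^[n] f) = (pderiv j)^[n] (pderiv i f) := by
  induction n generalizing f with
  | zero => rfl
  | succ n ih => rw [Function.iterate_succ_apply, ih, pderiv_pderiv_comm, Function.iterate_succ_apply]

theorem iterate_trace (H : NilpotentSystem u v h) (j : ℕ) :
    ∂₀ (∂₂^[j] u) = -∂₂^[j] (∂₁ v) := by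
  have h1 : ∂₀ u = -∂₁ v := eq_neg_of_add_eq_zero_left H.trace
  rw [iterate_pderiv_comm, h1, iterate_map_neg]

theorem iterate_minors (H : NilpotentSystem u v h) (j : ℕ) :
    ∂₁ (∂₂^[j + 1] u) * ∂₀ v + (j + 1 : ℕ) * (∂₁ (∂₂^[j] u) * ∂₀ (∂₂ v)) +
      ∂₂^[j + 2] u * ∂₀ h + (∂₂^[j + 1] (∂₁ v) * ∂₁ v +
        (j + 1 : ℕ) * (∂₂^[j] (∂₁ v) * ∂₁ (∂₂ v))) = 0 := by
  have h1 : ∂₀ u = -∂₁ v := eq_neg_of_add_eq_zero_left H.trace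
  have h2 : ∂₁ u * ∂₀ v + ∂₂ u * ∂₀ h + ∂₁ h * ∂₂ v + ∂₁ v * ∂₁ v = 0 := by
    have := H.minors
    rw [h1] at this
    linear_combination -this
  have h3 := congrArg (∂₂^[j + 1]) h2
  have hz : ∀ i, ∂₂ (pderiv i h) = 0 := fun i => by rw [pderiv_pderiv_comm, H.h_z, map_zero]
  have hv : ∀ i, ∂₂ (∂₂ (pderiv i v)) = 0 := fun i => by
    rw [pderiv_pderiv_comm 2 i, pderiv_pderiv_comm 2 i, H.v_zz, map_zero]
  rw [iterate_map_add, iterate_map_add, iterate_map_add, iterate_map_zero,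
    Derivation.iterate_mul_of_apply_apply_eq_zero _ _ _ (hv 0),
    Derivation.iterate_mul_of_apply_apply_eq_zero _ _ _ (hv 1),
    Derivation.iterate_mul_of_apply_apply_eq_zero _ _ _ (by rw [hz, map_zero]),
    Derivation.iterate_mul_of_apply_apply_eq_zero _ _ _ (by rw [H.v_zz, map_zero]),
    ← iterate_pderiv_comm, ← iterate_pderiv_comm, ← Function.iterate_succ_apply, hz 0, H.v_zz,
    Function.iterate_succ_apply _ _ (∂₁ h), hz 1, iterate_map_zero, pderiv_pderiv_comm 2 0,
    pderiv_pderiv_comm 2 1] at h3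
  linear_combination h3

theorem iterate_det (H : NilpotentSystem u v h) (j : ℕ) :
    ∂₂^[j + 2] u * (∂₀ v * ∂₁ h - ∂₁ v * ∂₀ h) +
      (j + 1 : ℕ) * (∂₂^[j + 1] u * (∂₀ (∂₂ v) * ∂₁ h - ∂₁ (∂₂ v) * ∂₀ h)) =
      ∂₂ v * (∂₀ (∂₂^[j + 1] u) * ∂₁ h - ∂₁ (∂₂^[j + 1] u) * ∂₀ h) := by
  have hz : ∀ i, ∂₂ (pderiv i h) = 0 := fun i => by rw [pderiv_pderiv_comm, H.h_z, map_zero]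
  have hv : ∀ i, ∂₂ (∂₂ (pderiv i v)) = 0 := fun i => by
    rw [pderiv_pderiv_comm 2 i, pderiv_pderiv_comm 2 i, H.v_zz, map_zero]
  have h1 : ∂₂ (∂₀ v * ∂₁ h - ∂₁ v * ∂₀ h) = ∂₀ (∂₂ v) * ∂₁ h - ∂₁ (∂₂ v) * ∂₀ h := by
    rw [map_sub, pderiv_mul, pderiv_mul, hz, hz, pderiv_pderiv_comm 2 0, pderiv_pderiv_comm 2 1]
    ring
  have h1' : ∂₂ (∂₂ (∂₀ v * ∂₁ h - ∂₁ v * ∂₀ h)) = 0 := by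
    rw [h1, map_sub, pderiv_mul, pderiv_mul, hz, hz, pderiv_pderiv_comm 2 0,
      pderiv_pderiv_comm 2 1, H.v_zz, map_zero, map_zero]
    ring
  have h2 : ∂₂ u * (∂₀ v * ∂₁ h - ∂₁ v * ∂₀ h) =
      (∂₀ u * ∂₁ h) * ∂₂ v - (∂₁ u * ∂₀ h) * ∂₂ v := by linear_combination H.det
  have h3 := congrArg (∂₂^[j + 1]) h2
  rw [iterate_map_sub,
    Derivation.iterate_mul_of_apply_apply_eq_zero _ _ _ h1', h1,
    Derivation.iterate_mul_of_apply_apply_eq_zero _ _ _ (by rw [H.v_zz, map_zero]),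
    Derivation.iterate_mul_of_apply_apply_eq_zero _ _ (∂₂ v) (by rw [H.v_zz, map_zero]),
    Derivation.iterate_mul_of_apply_apply_eq_zero _ _ (∂₁ h) (by rw [hz, map_zero]),
    Derivation.iterate_mul_of_apply_apply_eq_zero _ _ (∂₀ h) (by rw [hz, map_zero]),
    H.v_zz, hz, hz, ← iterate_pderiv_comm 0, ← iterate_pderiv_comm 1, ← Function.iterate_succ_apply,
    ← Function.iterate_succ_apply] at h3
  linear_combination h3

end NilpotentSystem

end System

theorem iterate_pderiv_eq_zero {K σ : Type*} [Field K] (i : σ) (n : ℕ) (f : MvPolynomial σ K)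
    (hf : degreeOf i f ≤ n) : (pderiv i)^[n + 1] f = 0 := by
  classical
  have hsupp : ∀ g : MvPolynomial σ K, ∀ m ∈ (pderiv i g).support, m i + 1 ≤ degreeOf i g := by
    intro g m hm
    rw [mem_support_iff, coeff_pderiv] at hm
    have h1 := (degreeOf_le_iff (n := i)).mp le_rfl _ (mem_support_iff.mpr (left_ne_zero_of_mul hm))
    simpa using h1
  induction n generalizing f with
  | zero =>
    rw [zero_add, Function.iterate_one, ← support_eq_empty, Finset.eq_empty_iff_forall_notMem]
    intro m hm
    have := hsupp f m hm
    lia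
  | succ n ih =>
    rw [Function.iterate_succ_apply]
    exact ih _ (degreeOf_le_iff.mpr fun m hm => by have := hsupp f m hm; lia)

/-! ### The `z`-degree of `u` is at most 1 -/

section System

variable {K : Type*} [Field K] [CharZero K]

local notation "∂₀" => pderiv (0 : Fin 3)
local notation "∂₁" => pderiv (1 : Fin 3)
local notation "∂₂" => pderiv (2 : Fin 3)

namespace NilpotentSystem

variable {u v h : MvPolynomial (Fin 3) K}

/-- There is no polynomial power `q ~ p ^ N` in the variable `y` that divides, up to a constant, a
product of `p'` with a polynomial of degree at most `deg p`. -/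
theorem false_of_power_dvd {a b k c : MvPolynomial (Fin 3) K} (N : ℕ) (hN : 2 ≤ N)
    (ha0 : ∂₀ a = 0) (ha2 : ∂₂ a = 0) (hb0 : ∂₀ b = 0) (hb2 : ∂₂ b = 0) (ha : a ≠ 0)
    (hb1 : ∂₁ b ≠ 0) (h1 : b * ∂₁ a = N * (a * ∂₁ b)) (h2 : a * k = c * ∂₁ b)
    (hc : c = b ∨ c = ∂₁ b) : False := by
  have hk : c * ∂₁ b ≠ 0 := by
    apply mul_ne_zero _ hb1
    rcases hc with rfl | rfl
    · rintro rfl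
      simp at hb1
    · exact hb1
  have hk0 : ∂₀ c = 0 ∧ ∂₂ c = 0 := by
    rcases hc with rfl | rfl
    · exact ⟨hb0, hb2⟩
    · rw [pderiv_pderiv_comm 0, pderiv_pderiv_comm 2, hb0, hb2]
      simp
  have hkk : ∀ i, pderiv i a = 0 → pderiv i c = 0 → pderiv i b = 0 → pderiv i k = 0 := by
    intro i h3 h4 h5
    have h6 := congrArg (pderiv i) h2
    rw [pderiv_mul, pderiv_mul, h3, h4, pderiv_pderiv_comm, h5, map_zero] at h6
    apply (mul_eq_zero.mp _).resolve_left ha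
    linear_combination h6
  obtain ⟨A, rfl⟩ := exists_eq_aeval_X_one ha0 ha2
  obtain ⟨B, rfl⟩ := exists_eq_aeval_X_one hb0 hb2
  obtain ⟨C', rfl⟩ := exists_eq_aeval_X_one hk0.1 hk0.2
  obtain ⟨k', rfl⟩ := exists_eq_aeval_X_one (hkk 0 ha0 hk0.1 hb0) (hkk 2 ha2 hk0.2 hb2)
  have hinj := aeval_X_injective (K := K) 1
  simp only [pderiv_aeval_X, pderiv_X_self, one_mul] at *
  have hA : A ≠ 0 := fun h => ha (by rw [h, map_zero])
  have hB' : Polynomial.derivative B ≠ 0 := fun h => hb1 (by rw [h, map_zero])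
  have hB : B ≠ 0 := by rintro rfl; simp at hB'
  have e1 : B * Polynomial.derivative A = N * (A * Polynomial.derivative B) := by
    apply hinj
    simpa using h1
  have e2 : A * k' = C' * Polynomial.derivative B := by
    apply hinj
    simpa using h2
  -- Everything depends on `y` alone, so degrees decide: `deg A = N deg B ≥ 2 deg B`, whereas `A`
  -- divides `C' B'`, of degree below `2 deg B`.
  have e3 := natDegree_eq_of_mul_derivative_eq hB hA N e1
  have hCB : C' * Polynomial.derivative B ≠ 0 := by
    intro h
    apply hk
    rw [← map_mul, h, map_zero]
  have hk' : k' ≠ 0 := by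
    rintro rfl
    rw [mul_zero] at e2
    exact hCB e2.symm
  have e4 := congrArg Polynomial.natDegree e2
  rw [Polynomial.natDegree_mul hA hk', Polynomial.natDegree_mul (left_ne_zero_of_mul hCB) hB'] at e4
  have e5 : C'.natDegree ≤ B.natDegree := by
    rcases hc with h | h
    · rw [hinj h]
    · rw [hinj h]
      exact (Polynomial.natDegree_derivative_le B).trans (Nat.sub_le _ _)
  have e6 : (Polynomial.derivative B).natDegree < B.natDegree := by
    apply Polynomial.natDegree_derivative_lt
    intro h
    exact hB' (Polynomial.derivative_eq_zero.mpr h)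
  have e7 : 2 * B.natDegree ≤ N * B.natDegree := Nat.mul_le_mul_right _ hN
  lia

omit [CharZero K] in
theorem iterate_pderiv_one_v (H : NilpotentSystem u v h) (j : ℕ) : ∂₂^[j + 2] (∂₁ v) = 0 := by
  rw [← iterate_pderiv_comm, Function.iterate_add_apply]
  change ∂₁ (∂₂^[j] (∂₂ (∂₂ v))) = 0
  rw [H.v_zz, iterate_map_zero, map_zero]

omit [CharZero K] in
/-- The equations satisfied by the top coefficients of `u` with respect to `z`. -/
theorem top_equations (H : NilpotentSystem u v h) (m : ℕ) (htop : ∂₂^[m + 3] u = 0)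
    {a b s t : MvPolynomial (Fin 3) K} (ha : a = ∂₂^[m + 2] u) (hb : b = ∂₂^[m + 1] u)
    (hs : s = ∂₂^[m] (∂₁ v)) (ht : t = ∂₂^[m + 1] (∂₁ v)) :
    ∂₂ a = 0 ∧ ∂₂ b = a ∧ ∂₀ a = 0 ∧ ∂₀ b = -t ∧
    (m + 3) * (∂₁ a * ∂₀ (∂₂ v)) = 0 ∧
    ∂₁ a * ∂₀ v + (m + 2) * (∂₁ b * ∂₀ (∂₂ v) + t * ∂₁ (∂₂ v)) = 0 ∧
    ∂₁ b * ∂₀ v + (m + 1) * (∂₁ (∂₂^[m] u) * ∂₀ (∂₂ v)) + a * ∂₀ h + t * ∂₁ v +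
      (m + 1) * (s * ∂₁ (∂₂ v)) = 0 ∧
    (m + 2) * (a * (∂₀ (∂₂ v) * ∂₁ h - ∂₁ (∂₂ v) * ∂₀ h)) = -(∂₂ v * (∂₁ a * ∂₀ h)) ∧
    a * (∂₀ v * ∂₁ h - ∂₁ v * ∂₀ h) +
      (m + 1) * (b * (∂₀ (∂₂ v) * ∂₁ h - ∂₁ (∂₂ v) * ∂₀ h)) =
      -(∂₂ v * (t * ∂₁ h + ∂₁ b * ∂₀ h)) := by
  have σ0 := H.iterate_pderiv_one_v
  have m2 := H.iterate_minors (m + 2)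
  have m1 := H.iterate_minors (m + 1)
  have m0 := H.iterate_minors m
  have d1 := H.iterate_det (m + 1)
  have d0 := H.iterate_det m
  have tr2 := H.iterate_trace (m + 2)
  have tr1 := H.iterate_trace (m + 1)
  have htop' : ∂₂^[m + 4] u = 0 := by
    rw [Function.iterate_succ_apply' ∂₂ (m + 3), htop, map_zero]
  rw [σ0, neg_zero] at tr2
  rw [show m + 2 + 2 = m + 4 from rfl, show m + 2 + 1 = m + 3 from rfl, htop, htop',
    σ0 m, show m + 3 = (m + 1) + 2 from rfl, σ0] at m2
  rw [show m + 1 + 2 = m + 3 from rfl, show m + 1 + 1 = m + 2 from rfl, htop, σ0] at m1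
  rw [show m + 1 + 2 = m + 3 from rfl, show m + 1 + 1 = m + 2 from rfl, htop, tr2] at d1
  rw [tr1] at d0
  rw [← ha] at m2 m1 m0 d1 d0 tr2
  rw [← hb] at m1 m0 d0 tr1
  rw [← ht] at m1 m0 d0 tr1
  rw [← hs] at m0
  push_cast at m2 m1 m0 d1 d0
  refine ⟨?_, ?_, tr2, tr1, ?_, ?_, ?_, ?_, ?_⟩
  · rw [ha, ← Function.iterate_succ_apply' ∂₂ (m + 2), htop]
  · rw [hb, ha, ← Function.iterate_succ_apply' ∂₂ (m + 1)]
  · rw [map_zero] at m2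
    linear_combination m2
  · linear_combination m1
  · linear_combination m0
  · linear_combination d1
  · linear_combination d0

/-- The supposed `z`-degree of `u` is `m + 2`; `a` is its leading coefficient up to a factorial. The
top equation gives `v_xz = 0`. For `m = 0`, unless `v_yz = 0`, `a` behaves like `v_z²` yet divides
`v_z v_yz`; for `m = 1` it behaves like `v_z³` yet divides `v_yz²`. Degrees exclude both. In the
other cases `v_x = h_x = 0`. -/
theorem false_of_top_nonconstant (H : NilpotentSystem u v h) (m : ℕ)
    (htop : ∂₂^[m + 3] u = 0) (hy : ∂₁ (∂₂^[m + 2] u) ≠ 0) : False := by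
  obtain ⟨a, ha⟩ : ∃ a, a = ∂₂^[m + 2] u := ⟨_, rfl⟩
  obtain ⟨b, hb⟩ : ∃ b, b = ∂₂^[m + 1] u := ⟨_, rfl⟩
  obtain ⟨s, hs⟩ : ∃ s, s = ∂₂^[m] (∂₁ v) := ⟨_, rfl⟩
  obtain ⟨t, ht⟩ : ∃ t, t = ∂₂^[m + 1] (∂₁ v) := ⟨_, rfl⟩
  obtain ⟨az, bz, ax, bx, m2, m1, m0, d1, d0⟩ := H.top_equations m htop ha hb hs ht
  rw [← ha] at hy
  have hm : ∀ k : ℕ, (m + (k + 1 : ℕ) : MvPolynomial (Fin 3) K) ≠ 0 := fun k => by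
    rw [← Nat.cast_add]
    exact Nat.cast_ne_zero.mpr (by lia)
  have ha_ne : a ≠ 0 := by
    rintro rfl
    exact hy (map_zero _)
  have v1x : ∂₀ (∂₂ v) = 0 :=
    (mul_eq_zero.mp ((mul_eq_zero.mp m2).resolve_left (hm 2))).resolve_left hy
  rw [v1x] at m1 m0 d1 d0
  have v1z := H.v_zz
  by_cases hm0 : m = 0
  · subst hm0
    have ht' : t = ∂₁ (∂₂ v) := by rw [ht]; exact pderiv_pderiv_comm 2 1 v
    have hs' : s = ∂₁ v := by rw [hs]; rfl
    rw [ht', hs'] at m0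
    rw [ht'] at m1 d0
    push_cast at m1 m0 d1 d0
    have key : ∂₁ (∂₂ v) * (∂₂ v * ∂₁ a - 2 * (a * ∂₁ (∂₂ v))) = 0 := by
      by_cases hx : ∂₀ h = 0
      · have hhy := H.h_ne hx
        rw [hx] at d0
        have h1 : a * ∂₀ v = -(∂₂ v * ∂₁ (∂₂ v)) := by
          apply mul_right_cancel₀ hhy
          linear_combination d0
        linear_combination ∂₁ a * h1 - a * m1
      · have h1 : ∂₂ v * ∂₁ a - 2 * (a * ∂₁ (∂₂ v)) = 0 := by
          apply mul_right_cancel₀ hx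
          linear_combination d1
        rw [h1, mul_zero]
    by_cases v1y : ∂₁ (∂₂ v) = 0
    · rw [v1y] at m1 m0
      have hvx : ∂₀ v = 0 := by
        apply (mul_eq_zero.mp _).resolve_left hy
        linear_combination m1
      rw [hvx] at m0
      have hhx : ∂₀ h = 0 := by
        apply (mul_eq_zero.mp _).resolve_left ha_ne
        linear_combination m0
      exact H.false_of_pderiv_zero_eq_zero hvx hhx
    · have h1 := (mul_eq_zero.mp key).resolve_left v1y
      refine false_of_power_dvd (a := a) (b := ∂₂ v) (k := -∂₀ v) (c := ∂₂ v) 2 le_rfl ax az v1x v1z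
        ha_ne v1y (by push_cast; linear_combination h1) ?_ (Or.inl rfl)
      have h2 : 2 * ∂₁ (∂₂ v) ≠ 0 := mul_ne_zero two_ne_zero v1y
      apply mul_left_cancel₀ h2
      linear_combination ∂₀ v * h1 - ∂₂ v * m1
  · obtain ⟨m, rfl⟩ := Nat.exists_eq_succ_of_ne_zero hm0
    have ht' : t = 0 := by rw [ht]; exact H.iterate_pderiv_one_v m
    rw [ht'] at m1 m0
    have hvx : ∂₀ v = 0 := by
      apply (mul_eq_zero.mp _).resolve_left hy
      linear_combination m1
    rw [hvx] at m0
    by_cases hhx : ∂₀ h = 0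
    · exact H.false_of_pderiv_zero_eq_zero hvx hhx
    rcases m with _ | m
    · have hs' : s = ∂₁ (∂₂ v) := by rw [hs]; exact pderiv_pderiv_comm 2 1 v
      rw [hs'] at m0
      push_cast at m0 d1
      have h1 : ∂₂ v * ∂₁ a = 3 * (a * ∂₁ (∂₂ v)) := by
        apply mul_right_cancel₀ hhx
        linear_combination d1
      have h2 : -2 * (∂₁ (∂₂ v) * ∂₁ (∂₂ v)) = a * ∂₀ h := by linear_combination -m0
      refine false_of_power_dvd (a := a) (b := ∂₂ v) (k := C (-1 / 2) * ∂₀ h) (c := ∂₁ (∂₂ v)) 3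
        (by norm_num) ax az v1x v1z ha_ne ?_ (by push_cast; exact h1) ?_ (Or.inr rfl)
      · intro h3
        rw [h3, mul_zero, mul_zero] at h2
        exact mul_ne_zero ha_ne hhx h2.symm
      · have h3 : (C (-1 / 2) : MvPolynomial (Fin 3) K) * (-2) = 1 := by
          rw [show (-2 : MvPolynomial (Fin 3) K) = C (-2) by rw [map_neg, map_ofNat], ← C_mul]
          norm_num
        linear_combination (-C (-1 / 2)) * h2 + (∂₁ (∂₂ v) * ∂₁ (∂₂ v)) * h3
    · have hs' : s = 0 := by rw [hs]; exact H.iterate_pderiv_one_v m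
      rw [hs'] at m0
      apply hhx
      apply (mul_eq_zero.mp _).resolve_left ha_ne
      linear_combination m0

omit [CharZero K] in
-- The determinant passes the dependence on to all pairs among `u, v, h`, leaving `u_z h_x + v_z h_y
-- = 0`. Its top `z`-coefficient gives `h_x = 0`, and then `h_y = 0`.
theorem false_of_dependent_v_h (H : NilpotentSystem u v h) (m : ℕ)
    (ha : ∂₂^[m + 2] u ≠ 0) (hv : ∂₂ v ≠ 0) (hvh : ∂₀ v * ∂₁ h - ∂₁ v * ∂₀ h = 0) : False := by
  have huh : ∂₀ u * ∂₁ h - ∂₁ u * ∂₀ h = 0 := by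
    have := H.det
    rw [hvh] at this
    apply (mul_eq_zero.mp _).resolve_left hv
    linear_combination -this
  have h0 : ∂₀ h * (∂₀ u * ∂₁ v - ∂₁ u * ∂₀ v) = 0 := by
    linear_combination ∂₀ v * huh - ∂₀ u * hvh
  have h1 : ∂₁ h * (∂₀ u * ∂₁ v - ∂₁ u * ∂₀ v) = 0 := by
    linear_combination ∂₁ v * huh - ∂₁ u * hvh
  have h2 : ∂₀ u * ∂₁ v - ∂₁ u * ∂₀ v = 0 := by
    rcases mul_eq_zero.mp h0 with h3 | h3
    · exact (mul_eq_zero.mp h1).resolve_left (H.h_ne h3)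
    · exact h3
  have h3 : ∂₂ u * ∂₀ h + ∂₁ h * ∂₂ v = 0 := by linear_combination h2 - H.minors
  have hz : ∀ i, ∂₂ (pderiv i h) = 0 := fun i => by rw [pderiv_pderiv_comm, H.h_z, map_zero]
  have h4 := congrArg (∂₂^[m + 1]) h3
  rw [iterate_map_add, iterate_map_zero,
    Derivation.iterate_mul_of_apply_apply_eq_zero _ _ _ (by rw [hz, map_zero]),
    Derivation.iterate_mul_of_apply_apply_eq_zero _ _ _ (by rw [H.v_zz, map_zero]),
    hz 0, H.v_zz, Function.iterate_succ_apply _ _ (∂₁ h), hz 1, iterate_map_zero,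
    ← Function.iterate_succ_apply] at h4
  have h5 : ∂₀ h = 0 := by
    apply (mul_eq_zero.mp _).resolve_left ha
    linear_combination h4
  rw [h5] at h3
  exact H.h_ne h5 ((mul_eq_zero.mp (by linear_combination h3)).resolve_right hv)

/-- The equations make `v_z` constant and express the gradient of `h` through that of `v` and `b_y`.
Once `b_y` is seen to be constant, the minors and determinant give `v_z = 0`, and `h` is a multiple
of `v` up to a constant. -/
theorem false_of_top_constant (H : NilpotentSystem u v h) (m : ℕ)
    (htop : ∂₂^[m + 3] u = 0) (ha_ne : ∂₂^[m + 2] u ≠ 0) (hy : ∂₁ (∂₂^[m + 2] u) = 0) : False := by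
  have hdep := H.false_of_dependent_v_h m ha_ne
  obtain ⟨a, ha⟩ : ∃ a, a = ∂₂^[m + 2] u := ⟨_, rfl⟩
  obtain ⟨b, hb⟩ : ∃ b, b = ∂₂^[m + 1] u := ⟨_, rfl⟩
  obtain ⟨s, hs⟩ : ∃ s, s = ∂₂^[m] (∂₁ v) := ⟨_, rfl⟩
  obtain ⟨t, ht⟩ : ∃ t, t = ∂₂^[m + 1] (∂₁ v) := ⟨_, rfl⟩
  obtain ⟨az, bz, ax, bx, -, m1, m0, d1, d0⟩ := H.top_equations m htop ha hb hs ht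
  rw [← ha] at hy ha_ne
  have hm : ∀ k : ℕ, (m + (k + 1 : ℕ) : MvPolynomial (Fin 3) K) ≠ 0 := fun k => by
    rw [← Nat.cast_add]
    exact Nat.cast_ne_zero.mpr (by lia)
  rw [hy] at m1 d1
  have hv1h : ∂₀ (∂₂ v) * ∂₁ h - ∂₁ (∂₂ v) * ∂₀ h = 0 := by
    have h1 : (m + (1 + 1 : ℕ) : MvPolynomial (Fin 3) K) *
        (a * (∂₀ (∂₂ v) * ∂₁ h - ∂₁ (∂₂ v) * ∂₀ h)) = 0 := by
      push_cast
      linear_combination d1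
    exact (mul_eq_zero.mp ((mul_eq_zero.mp h1).resolve_left (hm 1))).resolve_left ha_ne
  rw [hv1h] at d0
  have m1' : ∂₁ b * ∂₀ (∂₂ v) + t * ∂₁ (∂₂ v) = 0 := by
    have h1 : (m + (1 + 1 : ℕ) : MvPolynomial (Fin 3) K) *
        (∂₁ b * ∂₀ (∂₂ v) + t * ∂₁ (∂₂ v)) = 0 := by
      push_cast
      linear_combination m1
    exact (mul_eq_zero.mp h1).resolve_left (hm 1)
  have ht' : t = ∂₁ (∂₂ v) ∨ t = 0 := by
    rcases m with _ | m
    · exact Or.inl (by rw [ht]; exact pderiv_pderiv_comm 2 1 v)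
    · exact Or.inr (by rw [ht]; exact H.iterate_pderiv_one_v m)
  by_cases v1x : ∂₀ (∂₂ v) = 0
  swap
  · apply hdep
    · intro h1
      rw [h1, map_zero] at v1x
      exact v1x rfl
    · have h1 : t * ∂₁ h + ∂₁ b * ∂₀ h = 0 := by
        apply mul_left_cancel₀ v1x
        linear_combination t * hv1h + ∂₀ h * m1'
      rw [h1] at d0
      apply (mul_eq_zero.mp _).resolve_left ha_ne
      linear_combination d0
  rw [v1x] at m1' m0 hv1h
  have ht0 : t = 0 := by
    rcases ht' with h1 | h1
    · rw [h1] at m1' ⊢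
      apply pow_eq_zero_iff (two_ne_zero) |>.mp
      linear_combination m1'
    · exact h1
  rw [ht0] at m0 d0 bx
  by_cases hhx : ∂₀ h = 0
  · refine H.false_of_pderiv_zero_eq_zero ?_ hhx
    rw [hhx] at d0
    apply (mul_eq_zero.mp _).resolve_left (mul_ne_zero ha_ne (H.h_ne hhx))
    linear_combination d0
  have v1y : ∂₁ (∂₂ v) = 0 := by
    apply (mul_eq_zero.mp _).resolve_right hhx
    linear_combination -hv1h
  rw [v1y] at m0
  have e1 : a * ∂₀ h = -(∂₁ b * ∂₀ v) := by linear_combination m0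
  have hvx : ∂₀ v ≠ 0 := by
    intro h1
    rw [h1, mul_zero, neg_zero] at e1
    exact mul_ne_zero ha_ne hhx e1
  have e2 : a * a * ∂₁ h + a * ∂₁ b * ∂₁ v = ∂₂ v * ∂₁ b ^ 2 := by
    apply mul_right_cancel₀ hvx
    linear_combination a * d0 + (a * ∂₁ v - ∂₂ v * ∂₁ b) * e1
  have bxy : ∂₀ (∂₁ b) = 0 := by rw [pderiv_pderiv_comm, bx, neg_zero, map_zero]
  -- Equality of the mixed derivatives of `h` computed from `e1` and `e2`.
  have byy : ∂₁ (∂₁ b) = 0 := by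
    have f1 := congrArg ∂₀ e2
    have f2 := congrArg ∂₁ e1
    simp only [map_add, map_neg, pderiv_mul, pderiv_pow, ax, hy, bxy, v1x, pderiv_pderiv_comm 0 1 h,
      pderiv_pderiv_comm 0 1 v] at f1 f2
    apply mul_right_cancel₀ (mul_ne_zero ha_ne hvx)
    linear_combination a * f2 - f1
  obtain ⟨c, hc⟩ : ∃ c, a = C c := by
    apply exists_eq_C_of_pderiv_eq_zero
    intro i
    fin_cases i
    exacts [ax, hy, az]
  obtain ⟨e', he'⟩ : ∃ c, ∂₁ b = C c := by
    apply exists_eq_C_of_pderiv_eq_zero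
    intro i
    fin_cases i
    exacts [bxy, byy, by change ∂₂ (∂₁ b) = 0; rw [pderiv_pderiv_comm, bz, hy]]
  have hc0 : c ≠ 0 := by
    rintro rfl
    exact ha_ne (by rw [hc, map_zero])
  -- Normalised so that `h_x = e v_x`.
  obtain ⟨e, he⟩ : ∃ e, e' = -(c * e) := ⟨-e' / c, by field_simp⟩
  rw [he', he, hc] at e1 e2
  have hC : (C c : MvPolynomial (Fin 3) K) ≠ 0 := by rwa [Ne, C_eq_zero]
  simp only [map_neg, map_mul] at e1 e2
  have g0 : ∂₀ h = C e * ∂₀ v := by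
    apply mul_left_cancel₀ hC
    linear_combination e1
  have g1 : ∂₁ h = C e * ∂₁ v + ∂₂ v * C e ^ 2 := by
    apply mul_left_cancel₀ (mul_ne_zero hC hC)
    linear_combination e2
  have he0 : (C e : MvPolynomial (Fin 3) K) ≠ 0 := by
    intro h1
    rw [h1, zero_mul] at g0
    exact hhx g0
  have hx : ∂₀ u = -∂₁ v := eq_neg_of_add_eq_zero_left H.trace
  have hmin := H.minors
  have hdet := H.det
  rw [g0, g1, hx] at hmin hdet
  have hv1 : ∂₂ v = 0 := by
    have h1 : C e ^ 3 * ∂₂ v ^ 3 = 0 := by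
      linear_combination -hdet - ∂₂ v * C e * hmin
    exact pow_eq_zero_iff (three_ne_zero) |>.mp
      ((mul_eq_zero.mp h1).resolve_left (pow_ne_zero 3 he0))
  rw [hv1] at g1
  refine H.false_of_proportional 0 e (-1) (by simp) ?_ ?_ ?_
  · rw [g0]; simp
  · rw [g1]; simp
  · rw [hv1, H.h_z]; simp

theorem u_zz (H : NilpotentSystem u v h) : ∂₂ (∂₂ u) = 0 := by
  classical
  have hex : ∃ n, ∂₂^[n] u = 0 :=
    ⟨_, iterate_pderiv_eq_zero 2 _ u le_rfl⟩
  have hn := Nat.find_spec hex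
  have hmin := fun k => Nat.find_min hex (m := k)
  set n := Nat.find hex
  rcases le_or_gt n 2 with h1 | h1
  · have h2 : ∂₂^[n + (2 - n)] u = 0 := by
      rw [add_comm, Function.iterate_add_apply, hn, iterate_map_zero]
    rwa [Nat.add_sub_of_le h1] at h2
  · exfalso
    obtain ⟨m, hm⟩ := Nat.exists_eq_add_of_lt h1
    rw [show n = m + 3 by lia] at hn hmin
    by_cases hy : ∂₁ (∂₂^[m + 2] u) = 0
    · exact H.false_of_top_constant m hn (hmin (m + 2) (by lia)) hy
    · exact H.false_of_top_nonconstant m hn hy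

end NilpotentSystem

end System

/-! ### The `z`-coefficients of `u` and `v` are constant -/

section System

variable {K : Type*} [Field K] [IsAlgClosed K] [CharZero K]

local notation "∂₀" => pderiv (0 : Fin 3)
local notation "∂₁" => pderiv (1 : Fin 3)
local notation "∂₂" => pderiv (2 : Fin 3)

/-- A planar polynomial map with nilpotent Jacobian matrix has linearly dependent gradients. -/
theorem planar_nilpotent {u v : MvPolynomial (Fin 3) K} (hu : ∂₂ u = 0) (hy : ∂₁ u ≠ 0)
    (htr : ∂₀ u = -∂₁ v) (hdet : ∂₀ u * ∂₁ v - ∂₁ u * ∂₀ v = 0) :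
    ∃ β : K, ∂₀ u = -C β * ∂₁ u ∧ ∂₁ v = C β * ∂₁ u ∧ ∂₀ v = C β * ∂₀ u := by
  -- With `h = 0` the second conclusion reads `2α u_y³ = 0`, so the level curves are parallel lines.
  obtain ⟨α, β, h1, h2⟩ := hessian_core u (-v) 0 hu hy (by rw [map_neg, htr])
    (by rw [map_neg, map_zero]; linear_combination -hdet + ∂₀ u * htr) (by simp)
  have h3 : (C (2 * α) : MvPolynomial (Fin 3) K) = 0 := by
    apply (mul_eq_zero.mp _).resolve_right (pow_ne_zero 3 hy)
    simp only [map_zero, zero_mul, sub_zero] at h2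
    linear_combination h2
  rw [h3] at h1
  have h4 : ∂₀ u = -C β * ∂₁ u := by rw [h1]; ring
  refine ⟨β, h4, by linear_combination htr - h4, ?_⟩
  apply mul_left_cancel₀ hy
  linear_combination -hdet + ∂₀ u * htr - ∂₀ u * h4

namespace NilpotentSystem

variable {u v h : MvPolynomial (Fin 3) K}

omit [IsAlgClosed K] in
theorem const_of_first_const (H : NilpotentSystem u v h) (h0 : ∂₀ (∂₂ u) = 0)
    (h1 : ∂₁ (∂₂ u) = 0) (q1 : ∂₁ (∂₂ v) = 0)
    (m1 : ∂₁ u * ∂₀ (∂₂ v) = 0)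
    (d1 : ∂₂ u * (∂₀ (∂₂ v) * ∂₁ h - ∂₁ (∂₂ v) * ∂₀ h) =
      ∂₂ v * (∂₀ (∂₂ u) * ∂₁ h - ∂₁ (∂₂ u) * ∂₀ h)) : ∂₀ (∂₂ v) = 0 := by
  by_contra hx
  have hv : ∂₂ v ≠ 0 := by
    intro h; rw [h, map_zero] at hx; exact hx rfl
  have uy : ∂₁ u = 0 := (mul_eq_zero.mp m1).resolve_right hx
  have tr : ∂₀ u = -∂₁ v := eq_neg_of_add_eq_zero_left H.trace
  have hdet := H.det
  have hmin := H.minors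
  rw [h0, h1, q1] at d1
  rw [uy] at hdet hmin
  by_cases hy : ∂₁ h = 0
  · have hhx : ∂₀ h ≠ 0 := fun h' => H.h_ne h' hy
    rw [hy] at hdet hmin
    have h2 : ∂₂ u * ∂₁ v = 0 := by
      apply mul_right_cancel₀ hhx
      linear_combination -hdet
    have h3 : ∂₁ v = 0 := by
      rcases mul_eq_zero.mp h2 with h3 | h3
      · rw [h3, tr] at hmin
        apply pow_eq_zero_iff (two_ne_zero) |>.mp
        linear_combination -hmin
      · exact h3
    rw [h3] at hmin
    have h4 : ∂₂ u = 0 := by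
      apply mul_right_cancel₀ hhx
      linear_combination -hmin
    exact H.false_of_proportional 1 0 0 (by simp) (by simp [tr, h3]) (by simp [uy]) (by simp [h4])
  · have hu : ∂₂ u = 0 := by
      apply (mul_eq_zero.mp _).resolve_right (mul_ne_zero hx hy)
      linear_combination d1
    rw [hu] at hdet
    have h3 : ∂₀ u = 0 := by
      apply (mul_eq_zero.mp _).resolve_right (mul_ne_zero hv hy)
      linear_combination -hdet
    exact H.false_of_proportional 1 0 0 (by simp) (by simp [h3]) (by simp [uy]) (by simp [hu])

/-- The `z²`-part of the minors and the `z`-part of the trace make `(u_z, v_z)` a planar nilpotent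
map. If `u_z` depended on `y`, then `v_z = β u_z + k`. -/
theorem exists_pderiv_two_eq_C (H : NilpotentSystem u v h) :
    ∃ c₁ c₂ : K, ∂₂ u = C c₁ ∧ ∂₂ v = C c₂ := by
  have uzz := H.u_zz
  have vzz := H.v_zz
  have tr : ∂₀ u = -∂₁ v := eq_neg_of_add_eq_zero_left H.trace
  have tr1 : ∂₀ (∂₂ u) = -∂₁ (∂₂ v) := by
    rw [pderiv_pderiv_comm 0 2, tr, map_neg, pderiv_pderiv_comm 2 1]
  have c0 : ∀ f : MvPolynomial (Fin 3) K, ∂₂ (∂₀ f) = ∂₀ (∂₂ f) := pderiv_pderiv_comm 2 0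
  have c1 : ∀ f : MvPolynomial (Fin 3) K, ∂₂ (∂₁ f) = ∂₁ (∂₂ f) := pderiv_pderiv_comm 2 1
  have m1 := congrArg ∂₂ H.minors
  simp only [map_sub, pderiv_mul, map_zero, c0, c1, uzz, vzz,
    H.h_z] at m1
  have m2 := congrArg ∂₂ m1
  simp only [map_sub, map_add, pderiv_mul, map_zero, c0, c1, uzz, vzz, H.h_z] at m2
  have d1 := congrArg ∂₂ H.det
  simp only [map_sub, pderiv_mul, map_zero, c0, c1, uzz, vzz, H.h_z] at d1
  have m2' : ∂₀ (∂₂ u) * ∂₁ (∂₂ v) - ∂₁ (∂₂ u) * ∂₀ (∂₂ v) = 0 := by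
    have h2 : (2 : MvPolynomial (Fin 3) K) ≠ 0 := two_ne_zero
    apply mul_left_cancel₀ h2
    linear_combination m2
  have d1' : ∂₂ u * (∂₀ (∂₂ v) * ∂₁ h - ∂₁ (∂₂ v) * ∂₀ h) =
      ∂₂ v * (∂₀ (∂₂ u) * ∂₁ h - ∂₁ (∂₂ u) * ∂₀ h) := by linear_combination d1
  suffices hs : ∂₀ (∂₂ u) = 0 ∧ ∂₁ (∂₂ u) = 0 ∧ ∂₀ (∂₂ v) = 0 ∧ ∂₁ (∂₂ v) = 0 by
    obtain ⟨c₁, hc₁⟩ := exists_eq_C_of_pderiv_eq_zero (f := ∂₂ u) (by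
      intro i; fin_cases i; exacts [hs.1, hs.2.1, uzz])
    obtain ⟨c₂, hc₂⟩ := exists_eq_C_of_pderiv_eq_zero (f := ∂₂ v) (by
      intro i; fin_cases i; exacts [hs.2.2.1, hs.2.2.2, vzz])
    exact ⟨c₁, c₂, hc₁, hc₂⟩
  by_cases hy : ∂₁ (∂₂ u) = 0
  · have hx : ∂₀ (∂₂ u) = 0 := by
      rw [hy] at m2'
      apply pow_eq_zero_iff (two_ne_zero) |>.mp
      linear_combination -m2' + ∂₀ (∂₂ u) * tr1
    have vy : ∂₁ (∂₂ v) = 0 := by linear_combination tr1 - hx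
    refine ⟨hx, hy, ?_, vy⟩
    refine H.const_of_first_const hx hy vy ?_ d1'
    rw [hx, hy, vy] at m1
    linear_combination -m1
  · exfalso
    obtain ⟨β, b1, b2, b3⟩ := planar_nilpotent uzz hy tr1 m2'
    obtain ⟨k, hk⟩ : ∃ k, ∂₂ v - C β * ∂₂ u = C k := by
      apply exists_eq_C_of_pderiv_eq_zero
      intro i
      rw [map_sub, pderiv_C_mul]
      fin_cases i
      · exact sub_eq_zero.mpr b3
      · exact sub_eq_zero.mpr b2
      · change ∂₂ (∂₂ v) - C β * ∂₂ (∂₂ u) = 0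
        rw [uzz, vzz]; ring
    have hk' : ∂₂ v = C β * ∂₂ u + C k := by linear_combination hk
    have hmin := H.minors
    have hdet := H.det
    -- `v - β u` is constant along `(1, β)`
    have hq : ∂₀ v - C β * ∂₀ u + C β * (∂₁ v - C β * ∂₁ u) = 0 := by
      apply mul_left_cancel₀ hy
      rw [b3, b2, b1] at m1
      linear_combination -m1
    -- In both cases `u` and `h` are constant along `(1, β)`. For `k = 0` the trace then contradicts
    -- `hqy`; for `k ≠ 0` the minors reduce to `k h_y = 0`.
    by_cases hk0 : k = 0
    · rw [hk0, map_zero, add_zero] at hk'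
      have hqy : ∂₁ v - C β * ∂₁ u ≠ 0 := by
        intro h1
        rw [h1] at hq
        refine H.false_of_proportional (-β) 1 0 (by simp) ?_ ?_ ?_
        · simp only [map_neg, map_one, map_zero]; linear_combination hq
        · simp only [map_neg, map_one, map_zero]; linear_combination h1
        · rw [hk']; simp
      have hu1 : ∂₂ u ≠ 0 := by
        intro h1; rw [h1, map_zero] at hy; exact hy rfl
      have hh : ∂₀ h + C β * ∂₁ h = 0 := by
        apply mul_left_cancel₀ (mul_ne_zero hu1 hqy)
        rw [hk'] at hdet
        linear_combination -hdet + ∂₂ u * ∂₁ h * hq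
      have huu : ∂₀ u + C β * ∂₁ u = 0 := by
        apply mul_left_cancel₀ hqy
        rw [hk'] at hmin
        linear_combination hmin + ∂₂ u * hh + ∂₁ u * hq
      apply hqy
      linear_combination H.trace - huu
    · have hCk : (C k : MvPolynomial (Fin 3) K) ≠ 0 := by rwa [Ne, C_eq_zero]
      have hh : ∂₀ h + C β * ∂₁ h = 0 := by
        apply mul_left_cancel₀ (mul_ne_zero hCk hy)
        rw [b3, b2, b1, hk'] at d1'
        linear_combination d1'
      have hhy : ∂₁ h ≠ 0 := by
        intro h1
        rw [h1, mul_zero, add_zero] at hh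
        exact H.h_ne hh h1
      have huu : ∂₀ u + C β * ∂₁ u = 0 := by
        apply mul_left_cancel₀ (mul_ne_zero hCk hhy)
        rw [hk'] at hdet
        linear_combination -hdet + (∂₂ u * (C β * ∂₁ u - ∂₁ v) + C k * ∂₁ u ) * hh + ∂₂ u * ∂₁ h * hq
      apply mul_ne_zero hCk hhy
      rw [hk'] at hmin
      linear_combination -hmin - ∂₂ u * hh - ∂₁ u * hq + (∂₁ v - C β * ∂₁ u) * huu

end NilpotentSystem

end System

/-! ### Integration to the first form -/

section System

variable {K : Type*} [Field K] [IsAlgClosed K] [CharZero K]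

local notation "∂₀" => pderiv (0 : Fin 3)
local notation "∂₁" => pderiv (1 : Fin 3)
local notation "∂₂" => pderiv (2 : Fin 3)

omit [IsAlgClosed K] in
theorem eq_zero_of_pderiv_eq_zero_of_eval_eq_zero {f : MvPolynomial (Fin 3) K} (h0 : ∂₀ f = 0)
    (h1 : ∂₁ f = 0) (h2 : ∂₂ f = 0) (he : eval 0 f = 0) : f = 0 := by
  obtain ⟨c, rfl⟩ := exists_eq_C_of_pderiv_eq_zero (f := f) (by
    intro i; fin_cases i; exacts [h0, h1, h2])
  rw [eval_C] at he
  rw [he, map_zero]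

omit [IsAlgClosed K] in
/-- A polynomial in `x, y` that is constant along the curves `y = s(x) + c` is a polynomial in
`y - s(x)`. -/
theorem exists_eq_aeval_sub {f : MvPolynomial (Fin 3) K} (s : Polynomial K)
    (h0 : ∂₀ f = -(Polynomial.aeval (X 0) (Polynomial.derivative s) * ∂₁ f)) (h2 : ∂₂ f = 0) :
    ∃ g : Polynomial K, shear s f = Polynomial.aeval (X 1) g ∧
      f = Polynomial.aeval (X 1 + Polynomial.aeval (X 0) (-s)) g := by
  have e0 : ∂₀ (shear s f) = 0 := by
    rw [pderiv_shear_zero, h0, map_neg, map_mul, ← Polynomial.aeval_algHom_apply, shear_X_zero]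
    ring
  obtain ⟨g, hg⟩ := exists_eq_aeval_X_one e0 (by rw [pderiv_shear_two, h2, map_zero])
  refine ⟨g, hg, ?_⟩
  rw [← shear_neg_shear s f, hg, ← Polynomial.aeval_algHom_apply, shear_X_one]

namespace NilpotentSystem

variable {u v h : MvPolynomial (Fin 3) K}

omit [IsAlgClosed K] in
-- Otherwise `u_x` is an eigenvalue of a nilpotent matrix, hence zero, and `u` is constant.
theorem pderiv_one_ne_zero (H : NilpotentSystem u v h) (hu : ∂₂ u = 0) : ∂₁ u ≠ 0 := by
  intro hy
  have hdet := H.det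
  have hmin := H.minors
  have tr := H.trace
  rw [hu, hy] at hdet hmin
  have h1 : ∂₀ u ^ 3 = 0 := by linear_combination -∂₀ u * hmin + ∂₀ u ^ 2 * tr + hdet
  have h2 : ∂₀ u = 0 := pow_eq_zero_iff (three_ne_zero) |>.mp h1
  exact H.false_of_proportional 1 0 0 (by simp) (by simp [h2]) (by simp [hy]) (by simp [hu])

theorem hasFirstForm (H : NilpotentSystem u v h) (hu : ∂₂ u = 0) (eu : eval 0 u = 0)
    (ev : eval 0 v = 0) (eh : eval 0 h = 0) : HasFirstForm ![u, v, h] := by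
  have hy := H.pderiv_one_ne_zero hu
  obtain ⟨-, k, -, hk⟩ := H.exists_pderiv_two_eq_C
  have hdet := H.det
  have hmin := H.minors
  have tr : ∂₀ u = -∂₁ v := eq_neg_of_add_eq_zero_left H.trace
  rw [hu, hk] at hdet hmin
  have hk0 : k ≠ 0 := by
    rintro rfl
    rw [map_zero] at hmin
    obtain ⟨β, -, b2, b3⟩ := planar_nilpotent hu hy tr (by linear_combination hmin)
    refine H.false_of_proportional (-β) 1 0 (by simp) ?_ ?_ ?_
    · rw [b3]; simp
    · rw [b2]; simp
    · rw [hu, hk]; simp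
  have hCk : (C k : MvPolynomial (Fin 3) K) ≠ 0 := by rwa [Ne, C_eq_zero]
  have huh : ∂₀ u * ∂₁ h = ∂₁ u * ∂₀ h := by
    apply mul_left_cancel₀ hCk
    linear_combination -hdet
  obtain ⟨α, β, h1, h2⟩ := hessian_core u (-v) (C k * h) hu hy (by rw [map_neg, tr])
    (by rw [map_neg, pderiv_C_mul]; linear_combination -hmin + ∂₀ u * tr)
    (by rw [pderiv_C_mul, pderiv_C_mul]; linear_combination C k * huh)
  have h2α : (C (2 * α) : MvPolynomial (Fin 3) K) = 2 * C α := by rw [C_mul, map_ofNat]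
  rw [h2α] at h1 h2
  set s : Polynomial K := Polynomial.C α * Polynomial.X ^ 2 + Polynomial.C β * Polynomial.X with hs
  have hs' : Polynomial.aeval (X 0 : MvPolynomial (Fin 3) K) (Polynomial.derivative s) =
      2 * C α * X 0 + C β := by
    simp [hs, MvPolynomial.algebraMap_eq]
    ring
  have hhx : ∂₀ h = -(Polynomial.aeval (X 0) (Polynomial.derivative s) * ∂₁ h) := by
    apply mul_left_cancel₀ hy
    rw [hs']
    linear_combination -huh + ∂₁ h * h1
  obtain ⟨g, hg, hg'⟩ := exists_eq_aeval_sub (f := u) s (by rw [hs', h1]; ring) hu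
  obtain ⟨G, hG, hG'⟩ := exists_eq_aeval_sub s hhx H.h_z
  -- Since `s` has no constant term, `y - s(x)` vanishes at the origin.
  have heval : ∀ (p : Polynomial K) (f : MvPolynomial (Fin 3) K),
      f = Polynomial.aeval (X 1 + Polynomial.aeval (X 0) (-s)) p → eval 0 f = p.eval 0 := by
    intro p f hf
    have : eval (0 : Fin 3 → K) (X 1 + Polynomial.aeval (X 0) (-s)) = 0 := by
      simp [hs]
    rw [hf, ← coe_aeval_eq_eval, RingHom.coe_coe, ← Polynomial.aeval_algHom_apply]
    rw [← coe_aeval_eq_eval, RingHom.coe_coe] at this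
    rw [this, Polynomial.coe_aeval_eq_eval]
  have g0 : g.eval 0 = 0 := by rw [← heval g u hg', eu]
  have G0 : G.eval 0 = 0 := by rw [← heval G h hG', eh]
  have hd : ∀ p : Polynomial K, ∂₁ (Polynomial.aeval (X 1 : MvPolynomial (Fin 3) K) p) =
      Polynomial.aeval (X 1) (Polynomial.derivative p) := fun p => by
    rw [pderiv_aeval_X, pderiv_X_self, one_mul]
  have hinj := aeval_X_injective (K := K) 1
  have hode : Polynomial.C k * (Polynomial.derivative (Polynomial.derivative G) *
      Polynomial.derivative g - Polynomial.derivative G *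
      Polynomial.derivative (Polynomial.derivative g)) =
      -2 * Polynomial.C α * Polynomial.derivative g ^ 3 := by
    apply hinj
    have h3 := congrArg (shear s) h2
    have hC : ∀ c : K, shear s (C c) = C c := fun c => (shear s).commutes c
    simp only [pderiv_C_mul, map_sub, map_mul, map_neg, map_pow, map_ofNat, ← pderiv_shear_one, hg,
      hG, hd, hC] at h3
    simp only [map_mul, map_sub, map_neg, map_pow, map_ofNat, Polynomial.aeval_C,
      MvPolynomial.algebraMap_eq]
    linear_combination h3
  have hg1 : Polynomial.derivative g ≠ 0 := by
    intro h3
    apply hy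
    apply shear_injective s
    rw [← pderiv_shear_one, hg, hd, h3, map_zero, map_zero]
  -- The ODE says that `(k G' + 2α g g') / g'` has zero derivative.
  obtain ⟨e, he⟩ := exists_eq_C_mul_of_wronskian_eq_zero (p := Polynomial.C k *
    Polynomial.derivative G + 2 * Polynomial.C α * (g * Polynomial.derivative g)) hg1 (by
      simp only [Polynomial.derivative_add, Polynomial.derivative_mul, Polynomial.derivative_C,
        Polynomial.derivative_ofNat]
      linear_combination -hode)
  have hGg : Polynomial.C k * G + Polynomial.C α * g ^ 2 - Polynomial.C e * g = 0 := by
    have h3 : Polynomial.derivative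
        (Polynomial.C k * G + Polynomial.C α * g ^ 2 - Polynomial.C e * g) = 0 := by
      simp only [Polynomial.derivative_add, Polynomial.derivative_sub, Polynomial.derivative_mul,
        Polynomial.derivative_C, Polynomial.derivative_pow, Nat.add_one_sub_one]
      rw [show (Polynomial.C ((2 : ℕ) : K)) = 2 from map_ofNat _ 2, pow_one]
      linear_combination he
    rw [Polynomial.eq_C_of_natDegree_eq_zero (Polynomial.derivative_eq_zero.mp h3),
      Polynomial.coeff_zero_eq_eval_zero]
    simp [g0, G0]
  have hkh : C k * h = -(C α * u ^ 2) + C e * u := by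
    have h3 := congrArg (Polynomial.aeval (X 1 + Polynomial.aeval (X 0 : MvPolynomial (Fin 3) K)
      (-s))) hGg
    simp only [map_add, map_sub, map_mul, map_pow, Polynomial.aeval_C, ← hg', ← hG', map_zero,
      MvPolynomial.algebraMap_eq] at h3
    linear_combination h3
  have hhu : h = C (-α / k) * u ^ 2 + C (e / k) * u := by
    apply mul_left_cancel₀ hCk
    have h4 : (C k : MvPolynomial (Fin 3) K) * C (-α / k) = -C α := by
      rw [← C_mul, ← map_neg, mul_div_cancel₀ _ hk0]
    have h5 : (C k : MvPolynomial (Fin 3) K) * C (e / k) = C e := by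
      rw [← C_mul, mul_div_cancel₀ _ hk0]
    linear_combination hkh - u ^ 2 * h4 - u * h5
  have hα : α ≠ 0 := by
    rintro rfl
    refine H.false_of_proportional (e / k) 0 (-1) (by simp) ?_ ?_ ?_ <;>
    · rw [hhu]
      simp
  have hquad : quadPoly (k * (-α / k) * 1) (-β) 0 = -s := by
    rw [mul_div_cancel₀ _ hk0, hs, quadPoly]
    simp
    ring
  -- The argument of `g` is normalised to `a = 1` and `b = -s`; `c₀` and `l₂` come from dividing
  -- `hkh` by `k`.
  refine ⟨g, k, -α / k, 1, -β, e / k, 0, hk0, div_ne_zero (neg_ne_zero.mpr hα) hk0, one_ne_zero, g0,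
    ?_, ?_, ?_, hhu⟩
  · rw [Nat.one_le_iff_ne_zero]
    intro h3
    exact hg1 (Polynomial.derivative_eq_zero.mpr h3)
  · rw [hquad, C_1, one_mul]
    exact hg'
  · rw [hquad, inv_one, C_1, one_mul, one_mul, ← hg', Polynomial.derivative_neg, map_neg, hs']
    change v = _
    rw [← sub_eq_zero]
    have hkhy := congrArg ∂₁ hkh
    simp only [map_add, map_neg, pow_two, pderiv_mul, pderiv_C] at hkhy
    have h3 : v - (C k * X 2 - -(2 * C α * X 0 + C β) * u - C (k * (e / k)) * X 0) =
        v - C k * X 2 - C α * (X 0 * u) - C α * (X 0 * u) - C β * u + C e * X 0 := by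
      rw [mul_div_cancel₀ _ hk0]
      ring
    rw [h3]
    have hne : ∀ i j : Fin 3, i ≠ j → pderiv j (X i : MvPolynomial (Fin 3) K) = 0 :=
      fun i j hij => pderiv_X_of_ne hij
    -- The formula for `v` holds because both sides have the same gradient and vanish at the origin.
    apply eq_zero_of_pderiv_eq_zero_of_eval_eq_zero
    · simp only [map_add, map_sub, pderiv_mul, pderiv_C, pderiv_X_self, hne 2 0 (by decide)]
      apply mul_left_cancel₀ hy
      linear_combination -hmin + ∂₀ u * tr - hkhy - ∂₀ u * h1
    · simp only [map_add, map_sub, pderiv_mul, pderiv_C, hne 2 1 (by decide),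
        hne 0 1 (by decide)]
      linear_combination tr - h1
    · simp only [map_add, map_sub, pderiv_mul, pderiv_C, pderiv_X_self, hne 0 2 (by decide),
        hk, hu]
      ring
    · simp only [map_add, map_sub, map_mul, eval_X, eval_C, eu, ev, Pi.zero_apply]
      ring

end NilpotentSystem

end System

/-! ### From nilpotency to the equations; symmetry and conjugation -/

section System

variable {K : Type*} [Field K] [IsAlgClosed K] [CharZero K]

local notation "∂₀" => pderiv (0 : Fin 3)
local notation "∂₁" => pderiv (1 : Fin 3)
local notation "∂₂" => pderiv (2 : Fin 3)

omit [IsAlgClosed K] in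
-- Over a domain, nilpotency kills `tr J`, `tr J²` and `det J`; the principal minors sum to `((tr
-- J)² - tr J²) / 2`. Vanishing at the origin upgrades linear independence to independence modulo
-- constants.
theorem nilpotentSystem_of_isNilpotent {u v h : MvPolynomial (Fin 3) K} (h_z : degreeOf 2 h = 0)
    (v_z : degreeOf 2 v ≤ 1)
    (H_zero : ∀ i, eval (0 : Fin 3 → K) ((![u, v, h] : Fin 3 → MvPolynomial (Fin 3) K) i) = 0)
    (H_indep : LinearIndependent K ![u, v, h])
    (H_nil : IsNilpotent (polyJacobian ![u, v, h])) : NilpotentSystem u v h := by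
  have hz : ∂₂ h = 0 := iterate_pderiv_eq_zero 2 0 h h_z.le
  set J := polyJacobian ![u, v, h] with hJ
  have htr : J.trace = 0 := (Matrix.isNilpotent_trace_of_isNilpotent H_nil).eq_zero
  have htr2 : (J * J).trace = 0 := by
    apply IsNilpotent.eq_zero
    apply Matrix.isNilpotent_trace_of_isNilpotent
    exact (Commute.refl J).isNilpotent_mul_right H_nil
  have hdet : J.det = 0 := by
    obtain ⟨n, hn⟩ := H_nil
    apply eq_zero_of_pow_eq_zero (n := n + 1)
    rw [← Matrix.det_pow, pow_succ, hn, zero_mul, Matrix.det_zero]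
  have htr' : ∂₀ u + ∂₁ v = 0 := by
    simpa [Matrix.trace, Fin.sum_univ_three, hJ, polyJacobian, hz] using htr
  refine ⟨hz, iterate_pderiv_eq_zero 2 1 v v_z, htr', ?_, ?_, ?_⟩
  · have h2 : (2 : MvPolynomial (Fin 3) K) ≠ 0 := two_ne_zero
    apply mul_left_cancel₀ h2
    simp [Matrix.trace, Fin.sum_univ_three, hJ, polyJacobian, hz, Matrix.mul_apply] at htr2
    linear_combination (∂₀ u + ∂₁ v) * htr' - htr2
  · rw [Matrix.det_fin_three] at hdet
    simp [hJ, polyJacobian, hz] at hdet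
    linear_combination hdet
  · intro a b c habc
    obtain ⟨k, hk⟩ := exists_eq_C_of_pderiv_eq_zero habc
    have h0 := H_zero 0
    have h1 := H_zero 1
    have h2 := H_zero 2
    have h3 := congrArg (eval (0 : Fin 3 → K)) hk
    simp at h0 h1 h2 h3
    rw [h0, h1, h2] at h3
    rw [Fintype.linearIndependent_iff] at H_indep
    have h5 := H_indep ![a, b, c] (by
      simp only [Fin.sum_univ_three, Matrix.cons_val_zero, Matrix.cons_val_one, Matrix.cons_val,
        ← C_mul']
      rw [hk, ← h3]
      simp)
    exact ⟨h5 0, h5 1, h5 2⟩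

namespace NilpotentSystem

variable {u v h : MvPolynomial (Fin 3) K}

/-- Exchanging `x` with `y` and `u` with `v` gives a system of the first kind; constancy of `u_z`
supplies the bound on the `z`-degree of its new second component. -/
theorem hasSecondForm (H : NilpotentSystem u v h) (hv : ∂₂ v = 0) (eu : eval 0 u = 0)
    (ev : eval 0 v = 0) (eh : eval 0 h = 0) : HasSecondForm ![u, v, h] := by
  obtain ⟨k, -, hk, -⟩ := H.exists_pderiv_two_eq_C
  let σ : Equiv.Perm (Fin 3) := Equiv.swap 0 1
  let φ : MvPolynomial (Fin 3) K →ₐ[K] MvPolynomial (Fin 3) K := rename σ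
  have hφ : ∀ f, φ (φ f) = f := fun f => by
    simp only [φ, rename_rename]
    rw [show (σ : Fin 3 → Fin 3) ∘ σ = id by ext i; simp [σ], rename_id_apply]
  have hinj : Function.Injective φ := Function.LeftInverse.injective hφ
  have p0 : ∀ f, ∂₀ (φ f) = φ (∂₁ f) := fun f => pderiv_rename σ.injective 1 f
  have p1 : ∀ f, ∂₁ (φ f) = φ (∂₀ f) := fun f => pderiv_rename σ.injective 0 f
  have p2 : ∀ f, ∂₂ (φ f) = φ (∂₂ f) := fun f => pderiv_rename σ.injective 2 f
  have hC : ∀ c, φ (C c) = C c := fun c => φ.commutes c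
  have h0 : ∀ f, eval 0 (φ f) = eval 0 f := fun f => by
    simp only [φ, eval_rename]
    rfl
  have x0 : φ (X 0) = X 1 := by simp [φ, σ]
  have x1 : φ (X 1) = X 0 := by simp [φ, σ]
  have x2 : φ (X 2) = X 2 := by
    simp only [φ, rename_X]
    rfl
  have H' : NilpotentSystem (φ v) (φ u) (φ h) := by
    refine ⟨?_, ?_, ?_, ?_, ?_, ?_⟩
    · rw [p2, H.h_z, map_zero]
    · rw [p2, p2, hk, pderiv_C, map_zero]
    · rw [p0, p1, ← map_add, add_comm, H.trace, map_zero]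
    · have := congrArg φ H.minors
      simp only [map_sub, map_mul, map_zero] at this
      rw [p0, p1, p1, p0, p2, p0, p2, p1]
      linear_combination this
    · have := congrArg φ H.det
      simp only [map_sub, map_mul, map_zero] at this
      rw [p0, p1, p1, p0, p2, p0, p2, p1]
      linear_combination this
    · intro a b c habc
      have h3 : C a * φ v + C b * φ u + C c * φ h = φ (C b * u + C a * v + C c * h) := by
        simp only [map_add, map_mul, hC]
        ring
      rw [h3] at habc
      have h4 := H.indep b a c (by
        intro i
        apply hinj
        rw [map_zero]
        fin_cases i
        · exact (p1 _).symm.trans (habc 1)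
        · exact (p0 _).symm.trans (habc 0)
        · exact (p2 _).symm.trans (habc 2))
      exact ⟨h4.2.1, h4.1, h4.2.2⟩
  obtain ⟨g, v₁, c₀, a, l₁, l₂, l, e1, e2, e3, e4, e5, f0, f1, f2⟩ :=
    H'.hasFirstForm (by rw [p2, hv, map_zero]) (by rw [h0, ev]) (by rw [h0, eu]) (by rw [h0, eh])
  refine ⟨g, v₁, c₀, a, l₁, l₂, l, e1, e2, e3, e4, e5, ?_, ?_, ?_⟩
  · have := congrArg φ f1
    simpa [hφ, hC, x0, x1, x2, ← Polynomial.aeval_algHom_apply] using this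
  · have := congrArg φ f0
    simpa [hφ, hC, x0, x1, x2, ← Polynomial.aeval_algHom_apply] using this
  · have := congrArg φ f2
    simpa [hφ, hC] using this

end NilpotentSystem

section Transvection

omit [IsAlgClosed K] [CharZero K]

/-- The substitution `x ↦ x + μ y`. -/
noncomputable def xTransvection (μ : K) : MvPolynomial (Fin 3) K →ₐ[K] MvPolynomial (Fin 3) K :=
  aeval ![X 0 + C μ * X 1, X 1, X 2]

theorem xTransvection_neg_xTransvection (μ : K) (f : MvPolynomial (Fin 3) K) :
    xTransvection (-μ) (xTransvection μ f) = f := by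
  have h : (xTransvection (-μ)).comp (xTransvection μ) = AlgHom.id K _ := by
    apply MvPolynomial.algHom_ext
    intro i
    fin_cases i <;> simp [xTransvection, MvPolynomial.algebraMap_eq]
  exact DFunLike.congr_fun h f

theorem xTransvection_injective (μ : K) : Function.Injective (xTransvection μ) :=
  Function.LeftInverse.injective (xTransvection_neg_xTransvection μ)

theorem pderiv_xTransvection (μ : K) (f : MvPolynomial (Fin 3) K) :
    ∂₀ (xTransvection μ f) = xTransvection μ (∂₀ f) ∧
    ∂₁ (xTransvection μ f) = C μ * xTransvection μ (∂₀ f) + xTransvection μ (∂₁ f) ∧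
    ∂₂ (xTransvection μ f) = xTransvection μ (∂₂ f) := by
  have x0 : xTransvection μ (X 0) = X 0 + C μ * X 1 := by simp [xTransvection]
  have x1 : xTransvection μ (X 1) = X 1 := by simp [xTransvection]
  have x2 : xTransvection μ (X 2) = X 2 := by simp [xTransvection]
  induction f using MvPolynomial.induction_on with
  | C a => simp [← MvPolynomial.algebraMap_eq]
  | add p q hp hq =>
    simp only [map_add, hp, hq, true_and, and_true]
    ring
  | mul_X p i h =>
    obtain ⟨h0, h1, h2⟩ := h
    fin_cases i
    · simp [h0, h1, h2, x0, pderiv_X]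
      ring
    · simp [h0, h1, h2, x1, pderiv_X]
      ring
    · simp [h0, h1, h2, x2, pderiv_X]
      ring

end Transvection

namespace NilpotentSystem

variable {u v h : MvPolynomial (Fin 3) K}

omit [IsAlgClosed K] [CharZero K] in
-- The coefficients of the characteristic polynomial of the Jacobian are invariant under linear
-- conjugation, and this one leaves `z` alone.
theorem transvection (H : NilpotentSystem u v h) (μ : K) :
    NilpotentSystem (xTransvection μ u - C μ * xTransvection μ v) (xTransvection μ v)
      (xTransvection μ h) := by
  have p0 := fun f => (pderiv_xTransvection μ f).1
  have p1 := fun f => (pderiv_xTransvection μ f).2.1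
  have p2 := fun f => (pderiv_xTransvection μ f).2.2
  have tr := congrArg (xTransvection μ) H.trace
  simp only [map_add, map_zero] at tr
  refine ⟨?_, ?_, ?_, ?_, ?_, ?_⟩
  · rw [p2, H.h_z, map_zero]
  · rw [p2, p2, H.v_zz, map_zero]
  · rw [map_sub, pderiv_C_mul, p0, p0, p1]
    linear_combination tr
  · have := congrArg (xTransvection μ) H.minors
    simp only [map_sub, map_mul, map_zero] at this
    simp only [map_sub, pderiv_C_mul, p0, p1, p2]
    linear_combination this
  · have := congrArg (xTransvection μ) H.det
    simp only [map_sub, map_mul, map_zero] at this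
    simp only [map_sub, pderiv_C_mul, p0, p1, p2]
    linear_combination this
  · intro a b c habc
    have h3 : C a * (xTransvection μ u - C μ * xTransvection μ v) + C b * xTransvection μ v +
        C c * xTransvection μ h = xTransvection μ (C a * u + C (b - a * μ) * v + C c * h) := by
      simp only [map_add, map_mul, map_sub, show ∀ c : K, xTransvection μ (C c) = C c from
        fun c => (xTransvection μ).commutes c]
      ring
    rw [h3] at habc
    have e0 := habc 0
    have e1 := habc 1
    have e2 := habc 2
    rw [p0] at e0
    rw [p1, e0, mul_zero, zero_add] at e1
    rw [p2] at e2
    have h4 := H.indep a (b - a * μ) c (by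
      intro i
      apply xTransvection_injective μ
      rw [map_zero]
      fin_cases i
      exacts [e0, e1, e2])
    obtain ⟨ha, hb, hc⟩ := h4
    rw [ha, zero_mul, sub_zero] at hb
    exact ⟨ha, hb, hc⟩

theorem exists_linConj_hasFirstForm (H : NilpotentSystem u v h) (hv : ∂₂ v ≠ 0) (eu : eval 0 u = 0)
    (ev : eval 0 v = 0) (eh : eval 0 h = 0) :
    ∃ T : GL (Fin 3) K, HasFirstForm (linConj T ![u, v, h]) := by
  obtain ⟨c₁, c₂, hc₁, hc₂⟩ := H.exists_pderiv_two_eq_C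
  have hc₂0 : c₂ ≠ 0 := by
    rintro rfl
    rw [hc₂, map_zero] at hv
    exact hv rfl
  -- Chosen so that the `z`-coefficient `c₁ - μ c₂` of the new first component vanishes.
  set μ := c₁ / c₂ with hμ
  have p2 := fun f => (pderiv_xTransvection μ f).2.2
  let T : GL (Fin 3) K :=
    { val := !![1, μ, 0; 0, 1, 0; 0, 0, 1]
      inv := !![1, -μ, 0; 0, 1, 0; 0, 0, 1]
      val_inv := by ext i j; fin_cases i <;> fin_cases j <;> simp [Matrix.mul_apply, Fin.sum_univ_three]
      inv_val := by ext i j; fin_cases i <;> fin_cases j <;> simp [Matrix.mul_apply, Fin.sum_univ_three] }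
  have hT : ((T⁻¹ : GL (Fin 3) K) : Matrix (Fin 3) (Fin 3) K) = !![1, -μ, 0; 0, 1, 0; 0, 0, 1] := rfl
  have hT' : (T : Matrix (Fin 3) (Fin 3) K) = !![1, μ, 0; 0, 1, 0; 0, 0, 1] := rfl
  have hφ : bind₁ (fun k => ∑ l, C (T k l) * X l) = xTransvection μ := by
    apply MvPolynomial.algHom_ext
    intro i
    fin_cases i <;> simp [hT', Fin.sum_univ_three, xTransvection]
  have hconj : linConj T ![u, v, h] =
      ![xTransvection μ u - C μ * xTransvection μ v, xTransvection μ v, xTransvection μ h] := by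
    ext1 i
    simp only [linConj, hφ, hT]
    fin_cases i
    · simp [Fin.sum_univ_three]
      ring
    · simp [Fin.sum_univ_three]
    · simp [Fin.sum_univ_three]
  have h0 : ∀ f, eval 0 f = 0 → eval 0 (xTransvection μ f) = 0 := by
    intro f hf
    rw [← hf, xTransvection, ← coe_aeval_eq_eval, RingHom.coe_coe, ← AlgHom.comp_apply]
    congr 1
    apply MvPolynomial.algHom_ext
    intro i
    fin_cases i <;> simp
  refine ⟨T, ?_⟩
  rw [hconj]
  refine (H.transvection μ).hasFirstForm ?_ ?_ (h0 v ev) (h0 h eh)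
  · rw [map_sub, pderiv_C_mul, p2, p2, hc₁, hc₂, hμ,
      show ∀ c : K, xTransvection (c₁ / c₂) (C c) = C c from
        fun c => (xTransvection (c₁ / c₂)).commutes c,
      show ∀ c : K, xTransvection (c₁ / c₂) (C c) = C c from
        fun c => (xTransvection (c₁ / c₂)).commutes c, ← C_mul, div_mul_cancel₀ _ hc₂0, sub_self]
  · rw [map_sub, map_mul, h0 u eu, h0 v ev]
    ring

end NilpotentSystem

end System

/-! ### The three cases -/

theorem corollary4p2 {K : Type*} [Field K] [IsAlgClosed K] [CharZero K]
    (u v h : MvPolynomial (Fin 3) K)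
    (h_z : degreeOf 2 h = 0)
    (v_z : degreeOf 2 v ≤ 1)
    (H_zero : ∀ i, eval (0 : Fin 3 → K) ((![u, v, h] : Fin 3 → MvPolynomial (Fin 3) K) i) = 0)
    (H_indep : LinearIndependent K ![u, v, h])
    (H_nil : IsNilpotent (polyJacobian ![u, v, h])) :
    (degreeOf 2 u = 0 → Nat.gcd (degreeOf 1 u) (degreeOf 1 h) ≤ 3 →
      HasFirstForm ![u, v, h]) ∧
    (degreeOf 2 v = 0 → Nat.gcd (degreeOf 0 v) (degreeOf 0 h) ≤ 3 →
      HasSecondForm ![u, v, h]) ∧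
    (1 ≤ degreeOf 2 u * degreeOf 2 v →
      (∃ lam : K, Nat.gcd (atZZero u - C lam * atZZero v).totalDegree h.totalDegree ≤ 3) →
      ∃ T : GL (Fin 3) K, HasFirstForm (linConj T ![u, v, h])) := by
  have H := nilpotentSystem_of_isNilpotent h_z v_z H_zero H_indep H_nil
  have eu := H_zero 0
  have ev := H_zero 1
  have eh := H_zero 2
  refine ⟨fun hu _ => ?_, fun hv _ => ?_, fun huv _ => ?_⟩
  · exact H.hasFirstForm (iterate_pderiv_eq_zero 2 0 u hu.le) eu ev eh
  · exact H.hasSecondForm (iterate_pderiv_eq_zero 2 0 v hv.le) eu ev eh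
  · refine H.exists_linConj_hasFirstForm ?_ eu ev eh
    intro hv
    have h0 : degreeOf 2 v = 0 :=
      Nat.le_zero.mp (degreeOf_le_iff.mpr fun m hm =>
        (eq_zero_of_mem_support_of_pderiv_eq_zero hv m hm).le)
    rw [h0, mul_zero] at huv
    exact absurd huv (by norm_num)
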